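/- Let $T$ be a countable tree, possibly with vertices of infinite degree, in which every vertex has degree at least $3$. Let $P=(p(x,y))_{x,y\in T}$ be a stochastic matrix with $p(x,y)>0$ if and only if $x\sim y$, and let $\Gamma$ be a group of automorphisms of $T$ which acts transitively on the vertices and satisfies $p(\gamma x,\gamma y)=p(x,y)$ for all $\gamma\in\Gamma$ and $x,y\in T$. Let $I$ be the set of $\Gamma$-orbits on the set of oriented edges of $T$. For $j\in I$, the orbit of $(x,y)$, let $-j$ be the orbit of $(y,x)$ and $p_j=p(x,y)$; let $d_j$ be the (finite) number of neighbours $y$ of a fixed vertex $x$ such that $(x,y)$ belongs to $j$; these do not depend on the choices made. Assume that $\sum_{j\in I}d_jp_{-j}<\infty$ (which is automatic when $I$ is finite). Fix a vertex $o$ and put $\mathsf m(x)=\prod_{i=1}^k p(x_{i-1},x_i)/p(x_i,x_{i-1})$ when $o=x_0,x_1,\dots,x_k=x$ is the geodesic path from $o$ to $x$. Then $P$ acts as a bounded self-adjoint operator on $\ell^2(T,\mathsf m)$. For $\lambda$ in its resolvent set let $G(\lambda)=\bigl((\lambda-P)^{-1}\mathbf 1_x\bigr)(x)$, which does not depend on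 $x\in T$. Let $\rho=\limsup_{n}p^{(n)}(o,o)^{1/n}$ be the spectral radius, where $p^{(n)}(x,y)$ are the entries of $P^n$, let $\kappa=\max_{j\in I}2\sqrt{p_jp_{-j}}$, and set $$\mathcal U=\{\lambda\in\mathbb C:|\lambda|>\rho\}\setminus\{\pm it:\rho<t\le\kappa\},\qquad \mathcal W=\mathbb C\setminus\{\pm it: t\ge 1/\kappa\},$$ $$\Phi(t)=1+\sum_{j\in I}\frac{d_j}{2}\Bigl(\sqrt{1+4p_jp_{-j}t^2}-1\Bigr)$$ with the principal branch of the square root. Then the series defining $\Phi$ converges absolutely on $\mathcal W$, and $\Phi$ is analytic on $\mathcal W$. Every $\lambda\in\mathcal U$ belongs to the resolvent set of $P$, $G(\lambda)\in\mathcal W$, and $$\lambda\,G(\lambda)=\Phi\bigl(G(\lambda)\bigr).$$ Furthermore, $\Phi$ is real on the real line, there is a unique real $\theta>0$ with $\Phi'(\theta)=\Phi(\theta)/\theta$, and $$\rho=\min\{\Phi(t)/t:t>0\}=\Phi(\theta)/\theta .$$ -/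

import Mathlib

open MeasureTheory Filter
open scoped ENNReal

namespace TreeWalk

/-- A nearest neighbour random walk on a tree `T` (vertices of infinite degree are allowed):
a stochastic matrix `p` with `p x y > 0` exactly when `x` and `y` are neighbours. -/
structure Walk {V : Type*} (T : SimpleGraph V) where
  isTree : T.IsTree
  p : V → V → ℝ
  nonneg : ∀ x y, 0 ≤ p x y
  pos_iff : ∀ x y, 0 < p x y ↔ T.Adj x y
  hasSum_one : ∀ x, HasSum (p x) 1

namespace Walk

variable {V : Type*} {T : SimpleGraph V} (X : Walk T)

open Classical in
/-- The `n`-step transition probabilities, i.e. the entries of the matrix power `Pⁿ`. -/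
noncomputable def pn : ℕ → V → V → ℝ
  | 0, x, y => if x = y then 1 else 0
  | n + 1, x, y => ∑' z, X.p x z * pn n z y

/-- The spectral radius `ρ = limsup pⁿ(o,o)^(1/n)`.
(The value does not depend on the choice of the vertex `o`.) -/
noncomputable def rho (o : V) : ℝ :=
  limsup (fun n : ℕ => X.pn n o o ^ (1 / (n : ℝ))) atTop

/-- The geodesic path from `x` to `y`. -/
noncomputable def geodesic (x y : V) : T.Walk x y := (X.isTree.existsUnique_path x y).choose

/-- The reversing measure: the product of `p(u,v) / p(v,u)` over the successive
edges `(u,v)` of the geodesic from the root `o` to `x`. -/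
noncomputable def mass (o x : V) : ℝ :=
  ((X.geodesic o x).darts.map fun d => X.p d.fst d.snd / X.p d.snd d.fst).prod

theorem mass_eq {o x : V} (q : T.Walk o x) (hq : q.IsPath) :
    X.mass o x = (q.darts.map fun d => X.p d.fst d.snd / X.p d.snd d.fst).prod := by
  have h := (X.isTree.existsUnique_path o x).choose_spec.2 q hq
  rw [mass, geodesic, ← h]

theorem mass_pos (o x : V) : 0 < X.mass o x := by
  refine List.prod_pos ?_
  intro a ha
  obtain ⟨d, -, rfl⟩ := List.mem_map.1 ha
  exact div_pos ((X.pos_iff _ _).2 d.adj) ((X.pos_iff _ _).2 d.adj.symm)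

theorem reversible_aux {o x y : V} (h : T.Adj x y) (q : T.Walk o x) (hq : q.IsPath)
    (hy : y ∉ q.support) : X.mass o x * X.p x y = X.mass o y * X.p y x := by
  have hq' : (q.concat h).IsPath := hq.concat hy h
  have h1 := ((X.pos_iff _ _).2 h.symm).ne'
  rw [X.mass_eq q hq, X.mass_eq _ hq']
  simp only [SimpleGraph.Walk.darts_concat, List.concat_eq_append, List.map_append,
    List.prod_append, List.map_cons, List.map_nil, List.prod_cons, List.prod_nil, mul_one]
  field_simp

theorem reversible (o x y : V) : X.mass o x * X.p x y = X.mass o y * X.p y x := by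
  by_cases h : T.Adj x y
  · obtain ⟨q, hq, -⟩ := X.isTree.existsUnique_path o x
    obtain ⟨q', hq', -⟩ := X.isTree.existsUnique_path o y
    by_cases hy : y ∈ q.support
    · have hx := X.isTree.isAcyclic.ne_mem_support_of_support_of_adj_of_isPath hq hq' h hy
      exact (X.reversible_aux h.symm q' hq' hx).symm
    · exact X.reversible_aux h q hq hy
  · have h1 : X.p x y = 0 :=
      le_antisymm (not_lt.1 fun h' => h ((X.pos_iff _ _).1 h')) (X.nonneg _ _)
    have h2 : X.p y x = 0 :=
      le_antisymm (not_lt.1 fun h' => h ((X.pos_iff _ _).1 h').symm) (X.nonneg _ _)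
    rw [h1, h2, mul_zero, mul_zero]

theorem tsum_p (x : V) : ∑' y, ENNReal.ofReal (X.p x y) = 1 := by
  rw [← ENNReal.ofReal_tsum_of_nonneg (X.nonneg x) (X.hasSum_one x).summable,
    (X.hasSum_one x).tsum_eq, ENNReal.ofReal_one]

theorem enorm_p (x y : V) : ‖(X.p x y : ℂ)‖ₑ = ENNReal.ofReal (X.p x y) := by
  rw [← ofReal_norm, Complex.norm_real, Real.norm_of_nonneg (X.nonneg x y)]

/-- The action of the transition matrix on functions, `Pf(x) = ∑ p(x,y) f(y)`. -/
noncomputable def act (f : V → ℂ) (x : V) : ℂ := ∑' y, (X.p x y : ℂ) * f y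

section Operator

variable [Countable V] [MeasurableSpace V] [DiscreteMeasurableSpace V]

/-- The measure on the vertex set that gives the point `x` the weight `mass o x`. -/
noncomputable def meas (o : V) : Measure V :=
  Measure.sum fun x => ENNReal.ofReal (X.mass o x) • Measure.dirac x

/-- The Hilbert space `ℓ²(T, m)` of complex functions on the vertices. -/
noncomputable abbrev L2 (o : V) := Lp ℂ 2 (X.meas o)

theorem meas_singleton (o x : V) : X.meas o {x} = ENNReal.ofReal (X.mass o x) := by
  rw [meas, Measure.sum_apply _ (measurableSet_singleton x), tsum_eq_single x]
  · simp
  · intro y hy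
    simp [hy]

theorem eq_of_ae {o : V} {f g : V → ℂ} (h : f =ᵐ[X.meas o] g) : f = g := by
  funext x
  by_contra hx
  have h0 : X.meas o {x} = 0 := measure_mono_null (by simpa using hx) (ae_iff.1 h)
  rw [X.meas_singleton, ENNReal.ofReal_eq_zero] at h0
  exact absurd (X.mass_pos o x) (not_lt.2 h0)

theorem lintegral_meas (o : V) (g : V → ℝ≥0∞) :
    ∫⁻ x, g x ∂(X.meas o) = ∑' x, ENNReal.ofReal (X.mass o x) * g x := by
  simp [meas, lintegral_sum_measure]

theorem sq_tsum_le (x : V) (f : V → ℂ) :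
    (∑' y, ENNReal.ofReal (X.p x y) * ‖f y‖ₑ) ^ 2 ≤
      ∑' y, ENNReal.ofReal (X.p x y) * ‖f y‖ₑ ^ 2 := by
  set ν : Measure V := Measure.sum fun y => ENNReal.ofReal (X.p x y) • Measure.dirac y with hν
  have hI : ∀ g : V → ℝ≥0∞, ∫⁻ y, g y ∂ν = ∑' y, ENNReal.ofReal (X.p x y) * g y := by
    intro g
    simp [hν, lintegral_sum_measure]
  have : IsProbabilityMeasure ν := ⟨by
    rw [← lintegral_one, hI]
    simpa using X.tsum_p x⟩
  have h := eLpNorm_le_eLpNorm_of_exponent_le (p := 1) (q := 2) (μ := ν) (f := f)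
    (by norm_num) (Measurable.of_discrete (f := f)).aestronglyMeasurable
  rw [eLpNorm_one_eq_lintegral_enorm, hI] at h
  have h2 : eLpNorm f 2 ν ^ 2 = ∑' y, ENNReal.ofReal (X.p x y) * ‖f y‖ₑ ^ 2 := by
    rw [← hI, eLpNorm_eq_lintegral_rpow_enorm_toReal (by norm_num) (by norm_num),
      ← ENNReal.rpow_natCast, ← ENNReal.rpow_mul]
    simp
  rw [← h2]
  gcongr

theorem eLpNorm_sq (o : V) (f : V → ℂ) :
    eLpNorm f 2 (X.meas o) ^ 2 = ∑' x, ENNReal.ofReal (X.mass o x) * ‖f x‖ₑ ^ 2 := by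
  rw [← X.lintegral_meas, eLpNorm_eq_lintegral_rpow_enorm_toReal (by norm_num) (by norm_num),
    ← ENNReal.rpow_natCast, ← ENNReal.rpow_mul]
  simp

theorem tsum_mass_le (o : V) (f : V → ℂ) :
    ∑' x, ENNReal.ofReal (X.mass o x) * (∑' y, ENNReal.ofReal (X.p x y) * ‖f y‖ₑ) ^ 2 ≤
      eLpNorm f 2 (X.meas o) ^ 2 := by
  rw [X.eLpNorm_sq]
  calc _ ≤ ∑' x, ENNReal.ofReal (X.mass o x) *
        ∑' y, ENNReal.ofReal (X.p x y) * ‖f y‖ₑ ^ 2 := by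
        gcongr with x
        exact X.sq_tsum_le x f
    _ = ∑' x, ∑' y, ENNReal.ofReal (X.mass o y) * ‖f y‖ₑ ^ 2 * ENNReal.ofReal (X.p y x) := by
        refine tsum_congr fun x => ?_
        rw [← ENNReal.tsum_mul_left]
        refine tsum_congr fun y => ?_
        rw [← mul_assoc, ← ENNReal.ofReal_mul (X.mass_pos o x).le, X.reversible,
          ENNReal.ofReal_mul (X.mass_pos o y).le]
        ring
    _ = _ := by
        rw [ENNReal.tsum_comm]
        refine tsum_congr fun y => ?_
        rw [ENNReal.tsum_mul_left, X.tsum_p, mul_one]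

theorem summable_act {o : V} {f : V → ℂ} (hf : MemLp f 2 (X.meas o)) (x : V) :
    Summable fun y => (X.p x y : ℂ) * f y := by
  have h1 := (ENNReal.le_tsum (f := fun x => ENNReal.ofReal (X.mass o x) *
    (∑' y, ENNReal.ofReal (X.p x y) * ‖f y‖ₑ) ^ 2) x).trans (X.tsum_mass_le o f)
  have h2 : ∑' y, ENNReal.ofReal (X.p x y) * ‖f y‖ₑ ≠ ∞ := by
    intro h
    have hm : ENNReal.ofReal (X.mass o x) ≠ 0 := by
      simpa using X.mass_pos o x
    simp only [h] at h1
    rw [ENNReal.top_pow (by norm_num), ENNReal.mul_top hm] at h1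
    exact (ENNReal.pow_lt_top hf.2).ne (top_le_iff.1 h1)
  refine Summable.of_enorm ?_
  convert h2 using 3 with y
  rw [enorm_mul, X.enorm_p]

theorem eLpNorm_act_le (o : V) (f : V → ℂ) :
    eLpNorm (X.act f) 2 (X.meas o) ≤ eLpNorm f 2 (X.meas o) := by
  have h : eLpNorm (X.act f) 2 (X.meas o) ^ 2 ≤ eLpNorm f 2 (X.meas o) ^ 2 := by
    refine le_trans ?_ (X.tsum_mass_le o f)
    rw [X.eLpNorm_sq]
    gcongr with x
    refine enorm_tsum_le_tsum_enorm.trans (le_of_eq (tsum_congr fun y => ?_))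
    rw [enorm_mul, X.enorm_p]
  exact (ENNReal.pow_le_pow_left_iff two_ne_zero).1 h

theorem memLp_act {o : V} {f : V → ℂ} (hf : MemLp f 2 (X.meas o)) :
    MemLp (X.act f) 2 (X.meas o) :=
  ⟨(Measurable.of_discrete (f := X.act f)).aestronglyMeasurable,
    (X.eLpNorm_act_le o f).trans_lt hf.2⟩

/-- The transition operator `P` on `ℓ²(T, m)`. -/
noncomputable def op (o : V) : X.L2 o →L[ℂ] X.L2 o :=
  LinearMap.mkContinuous
    { toFun := fun f => (X.memLp_act (Lp.memLp f)).toLp (X.act f)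
      map_add' := by
        intro f g
        rw [← MemLp.toLp_add]
        congr 1
        funext x
        rw [X.eq_of_ae (Lp.coeFn_add f g)]
        simp only [act, Pi.add_apply, mul_add]
        exact (X.summable_act (Lp.memLp f) x).tsum_add (X.summable_act (Lp.memLp g) x)
      map_smul' := by
        intro c f
        rw [RingHom.id_apply, ← MemLp.toLp_const_smul]
        congr 1
        funext x
        rw [X.eq_of_ae (Lp.coeFn_smul c f)]
        simp only [act, Pi.smul_apply, smul_eq_mul, mul_left_comm _ c]
        exact tsum_mul_left }
    1
    (by
      intro f
      rw [one_mul, LinearMap.coe_mk, AddHom.coe_mk, Lp.norm_toLp, Lp.norm_def]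
      exact ENNReal.toReal_mono (Lp.memLp f).2.ne (X.eLpNorm_act_le o f))

/-- The indicator function of the vertex `y`, as an element of `ℓ²(T, m)`. -/
noncomputable def delta (o y : V) : X.L2 o :=
  indicatorConstLp 2 (measurableSet_singleton y)
    (show X.meas o {y} ≠ ∞ by rw [X.meas_singleton]; exact ENNReal.ofReal_ne_top) (1 : ℂ)

/-- The Green function `G(x,y|z)`: the matrix element of the resolvent `(z - P)⁻¹` of the
operator `P` on `ℓ²(T, m)`, for `z` in the resolvent set. Every point of the measure space has
positive mass, so that the elements of `ℓ²(T, m)` are genuine functions. -/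
noncomputable def green (o x y : V) (z : ℂ) : ℂ :=
  (resolvent (X.op o) z (X.delta o y) : X.L2 o) x

end Operator

/-- The transition probabilities are invariant under the group `Γ` of tree automorphisms. -/
def Invariant (Γ : Subgroup (T ≃g T)) : Prop :=
  ∀ γ ∈ Γ, ∀ x y, X.p (γ x) (γ y) = X.p x y

end Walk

section Types

variable {V : Type*} {T : SimpleGraph V} (Γ : Subgroup (T ≃g T))

/-- The group `Γ` acts transitively on the vertices. -/
def Transitive : Prop := ∀ x y : V, ∃ γ ∈ Γ, γ x = y

/-- Two oriented edges are equivalent when they lie in the same `Γ`-orbit. -/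
def edgeSetoid : Setoid T.Dart where
  r d e := ∃ γ ∈ Γ, γ d.fst = e.fst ∧ γ d.snd = e.snd
  iseqv :=
    { refl := fun _ => ⟨1, Γ.one_mem, rfl, rfl⟩
      symm := by
        rintro d e ⟨γ, hγ, h1, h2⟩
        refine ⟨γ⁻¹, Γ.inv_mem hγ, ?_, ?_⟩
        · rw [← h1]; exact γ.symm_apply_apply _
        · rw [← h2]; exact γ.symm_apply_apply _
      trans := by
        rintro d e f ⟨γ, hγ, h1, h2⟩ ⟨δ, hδ, h3, h4⟩
        refine ⟨δ * γ, Γ.mul_mem hδ hγ, ?_, ?_⟩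
        · rw [← h3, ← h1]; rfl
        · rw [← h4, ← h2]; rfl }

/-- The set `I` of types: the orbits of `Γ` on the oriented edges. -/
def EdgeType : Type _ := Quotient (edgeSetoid Γ)

/-- The type of an oriented edge. -/
def edgeType (d : T.Dart) : EdgeType Γ := Quotient.mk (edgeSetoid Γ) d

/-- The involution `j ↦ -j` induced by the reversal of edges. -/
def EdgeType.neg : EdgeType Γ → EdgeType Γ :=
  Quotient.map' SimpleGraph.Dart.symm fun _ _ ⟨γ, hγ, h1, h2⟩ => ⟨γ, hγ, h2, h1⟩

/-- `d_j`: the number of neighbours `y` of `x` for which the edge `(x,y)` has type `j`. (It is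
finite for an invariant walk, and independent of `x` when `Γ` is transitive.) -/
noncomputable def EdgeType.deg (x : V) (j : EdgeType Γ) : ℕ :=
  {y : V | ∃ h : T.Adj x y, edgeType Γ ⟨(x, y), h⟩ = j}.ncard

variable {Γ}

/-- `p_j`: the value `p(x,y)` for an edge `(x,y)` of type `j`. -/
def Walk.pType (X : Walk T) (hinv : X.Invariant Γ) : EdgeType Γ → ℝ :=
  Quotient.lift (s := edgeSetoid Γ) (fun d => X.p d.fst d.snd) (by
    rintro d e ⟨γ, hγ, h1, h2⟩
    rw [← h1, ← h2]
    exact (hinv γ hγ _ _).symm)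

/-- The product `p_j p_{-j}`. -/
noncomputable def Walk.pp (X : Walk T) (hinv : X.Invariant Γ) (j : EdgeType Γ) : ℝ :=
  X.pType hinv j * X.pType hinv (EdgeType.neg Γ j)

/-- `κ`, the maximum of `2 √(p_j p_{-j})` over all types `j`. -/
noncomputable def Walk.kappa (X : Walk T) (hinv : X.Invariant Γ) : ℝ :=
  ⨆ j : EdgeType Γ, 2 * Real.sqrt (X.pp hinv j)

/-- The domain `𝒰`: all `z` with `|z| > ρ`, without the points `± i t` with `ρ < t ≤ κ`. -/
def Walk.domU (X : Walk T) (hinv : X.Invariant Γ) (o : V) : Set ℂ :=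
  {z : ℂ | X.rho o < ‖z‖} \
    {z : ℂ | ∃ t : ℝ, X.rho o < t ∧ t ≤ X.kappa hinv ∧
      (z = Complex.I * t ∨ z = -(Complex.I * t))}

/-- The slit plane `𝒲`: the complex plane without the points `± i t` with `t ≥ 1/κ`. -/
def Walk.domW (X : Walk T) (hinv : X.Invariant Γ) : Set ℂ :=
  {z : ℂ | ∃ t : ℝ, 1 / X.kappa hinv ≤ t ∧
      (z = Complex.I * t ∨ z = -(Complex.I * t))}ᶜ

/-- The term `(d_j / 2) (√(1 + 4 p_j p_{-j} t²) - 1)` (principal branch of the root). -/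
noncomputable def Walk.phiTerm (X : Walk T) (hinv : X.Invariant Γ) (o : V) (t : ℂ)
    (j : EdgeType Γ) : ℂ :=
  (EdgeType.deg Γ o j : ℂ) / 2 * (Complex.sqrt (1 + 4 * (X.pp hinv j : ℂ) * t ^ 2) - 1)

/-- The function `Φ(t) = 1 + ∑_j (d_j / 2) (√(1 + 4 p_j p_{-j} t²) - 1)` of a complex
variable. -/
noncomputable def Walk.Phi (X : Walk T) (hinv : X.Invariant Γ) (o : V) (t : ℂ) : ℂ :=
  1 + ∑' j : EdgeType Γ, X.phiTerm hinv o t j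

/-- The same function of a real variable, with the real square root. -/
noncomputable def Walk.PhiReal (X : Walk T) (hinv : X.Invariant Γ) (o : V) (t : ℝ) : ℝ :=
  1 + ∑' j : EdgeType Γ,
    (EdgeType.deg Γ o j : ℝ) / 2 * (Real.sqrt (1 + 4 * X.pp hinv j * t ^ 2) - 1)

end Types

end TreeWalk

/-! ### Transition probabilities and the spectral radius -/

namespace TreeWalk
namespace Walk

variable {V : Type*} {T : SimpleGraph V} (X : Walk T)

/-! The operator P is self-adjoint on ℓ²(T, m) because m is reversing, and its norm is at most ρ
(`norm_op_le`), so |z| > ρ puts z in the resolvent set. Cutting the tree at an edge xy gives a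
quadratic equation for G(y,x) (`green_cut`). As the diagonal G is constant, it reads (1 +
2p(x,y)G(y,x))² = 1 + 4p(x,y)p(y,x)G² (`green_adj_sq`). Once the bracket is known to be the
principal root, the resolvent identity zG = 1 + ∑ p(o,y)G(y,o) becomes the functional equation.

The choice of the root is the heart of the matter. Splitting the resolvent into its even and odd
parts gives G = z̄a − zb with 0 ≤ b < a and |G|² ≤ a (`exists_green_formula`). So G is imaginary
only if z is, and then |z||G| ≤ 1, so that |z| > κ keeps G off the slits (`green_mem_domW`). Hence
the square above avoids (−∞, 0] and the bracket never meets the imaginary axis. Along the ray tz, t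
≥ 1, it tends to 1, so its real part is positive throughout (`green_adj_re_pos`).

For the formula for ρ, each t > 0 yields a positive superharmonic function with factor Φ(t)/t,
whence ρ ≤ Φ(t)/t (`rho_le_phiReal_div`). Conversely, for real s > ρ the value g = G(s) is positive
and s = Φ(g)/g, so s is at least the minimum. The minimum is where a tangent of the convex function
Φ passes through the origin; this point exists and is unique because Φ − tΦ' decreases strictly from
1 and, with three neighbours, becomes negative. -/

theorem le_one (x y : V) : X.p x y ≤ 1 :=
  le_hasSum (X.hasSum_one x) y fun z _ => X.nonneg x z

theorem eq_zero_of_not_adj {x y : V} (h : ¬ T.Adj x y) : X.p x y = 0 :=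
  le_antisymm (not_lt.1 fun h' => h ((X.pos_iff _ _).1 h')) (X.nonneg _ _)

theorem pn_nonneg (n : ℕ) (x y : V) : 0 ≤ X.pn n x y := by
  induction n generalizing x with
  | zero => rw [pn]; split_ifs <;> norm_num
  | succ n ih => exact tsum_nonneg fun z => mul_nonneg (X.nonneg _ _) (ih z)

theorem summable_p_mul_of_le {f : V → ℝ} {C : ℝ} (hf0 : ∀ y, 0 ≤ f y) (hf : ∀ y, f y ≤ C)
    (x : V) : Summable fun z => X.p x z * f z :=
  .of_nonneg_of_le (fun z => mul_nonneg (X.nonneg _ _) (hf0 z))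
    (fun z => mul_le_mul_of_nonneg_left (hf z) (X.nonneg x z))
    ((X.hasSum_one x).summable.mul_right C)

theorem pn_le_one (n : ℕ) (x y : V) : X.pn n x y ≤ 1 := by
  induction n generalizing x with
  | zero => rw [pn]; split_ifs <;> norm_num
  | succ n ih =>
    rw [pn, ← (X.hasSum_one x).tsum_eq]
    refine (X.summable_p_mul_of_le (fun z => X.pn_nonneg n z y) ih x).tsum_le_tsum ?_
      (X.hasSum_one x).summable
    exact fun z => mul_le_of_le_one_right (X.nonneg _ _) (ih z)

/-- A positive `s`-superharmonic function bounds the growth of the transition probabilities. -/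
theorem pn_mul_le {h : V → ℝ} {s : ℝ} (hpos : ∀ x, 0 < h x) (hs : 0 ≤ s)
    (hsum : ∀ x, Summable fun z => X.p x z * h z) (hle : ∀ x, ∑' z, X.p x z * h z ≤ s * h x)
    (n : ℕ) (x y : V) : X.pn n x y * h y ≤ s ^ n * h x := by
  induction n generalizing x with
  | zero =>
    rw [pn]; split_ifs with hxy
    · simp [hxy]
    · simpa using (hpos x).le
  | succ n ih =>
    have h1 : ∀ z, X.p x z * X.pn n z y * h y ≤ s ^ n * (X.p x z * h z) := fun z => by
      have := mul_le_mul_of_nonneg_left (ih z) (X.nonneg x z)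
      nlinarith
    have h2 : Summable fun z => X.p x z * X.pn n z y * h y :=
      (X.summable_p_mul_of_le (fun z => X.pn_nonneg n z y) (fun z => X.pn_le_one n z y) x).mul_right _
    rw [pn, ← tsum_mul_right]
    calc _ ≤ ∑' z, s ^ n * (X.p x z * h z) := h2.tsum_le_tsum h1 ((hsum x).mul_left _)
      _ = s ^ n * ∑' z, X.p x z * h z := tsum_mul_left
      _ ≤ s ^ n * (s * h x) := mul_le_mul_of_nonneg_left (hle x) (pow_nonneg hs n)
      _ = _ := by ring

theorem pn_invariant {Γ : Subgroup (T ≃g T)} (hinv : X.Invariant Γ) {γ : T ≃g T} (hγ : γ ∈ Γ)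
    (n : ℕ) (x y : V) : X.pn n (γ x) (γ y) = X.pn n x y := by
  induction n generalizing x with
  | zero =>
    rw [pn, pn]
    by_cases h : x = y
    · rw [if_pos h, if_pos (congrArg γ h)]
    · rw [if_neg h, if_neg (γ.injective.ne h)]
  | succ n ih =>
    rw [pn, pn, ← γ.toEquiv.tsum_eq]
    exact tsum_congr fun z => congrArg₂ (· * ·) (hinv γ hγ x z) (ih z)

theorem rho_bdd (o : V) : IsBoundedUnder (· ≤ ·) atTop fun n : ℕ => X.pn n o o ^ (1 / (n : ℝ)) :=
  isBoundedUnder_of ⟨1, fun n => Real.rpow_le_one (X.pn_nonneg n o o) (X.pn_le_one n o o)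
    (by positivity)⟩

theorem rho_nonneg (o : V) : 0 ≤ X.rho o :=
  le_limsup_of_frequently_le (Frequently.of_forall fun n => Real.rpow_nonneg (X.pn_nonneg n o o) _)
    (X.rho_bdd o)

theorem rho_le_of_pn_le {o : V} {s : ℝ} (hs : 0 ≤ s) (h : ∀ n, X.pn n o o ≤ s ^ n) :
    X.rho o ≤ s := by
  refine limsup_le_of_le (isCoboundedUnder_le_of_le atTop
    fun n => Real.rpow_nonneg (X.pn_nonneg n o o) _) ?_
  -- At n = 0 the exponent `1 / 0` is `0` and the root identity below would fail.
  filter_upwards [eventually_ne_atTop 0] with n hn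
  calc _ ≤ (s ^ n) ^ (1 / (n : ℝ)) := Real.rpow_le_rpow (X.pn_nonneg _ _ _) (h n) (by positivity)
    _ = s := by rw [one_div, Real.pow_rpow_inv_natCast hs hn]

theorem eventually_pn_le {o : V} {s : ℝ} (hs : X.rho o < s) :
    ∀ᶠ n in atTop, X.pn n o o ≤ s ^ n := by
  filter_upwards [eventually_lt_of_limsup_lt hs (X.rho_bdd o), eventually_ne_atTop 0] with n hn h0
  have := pow_le_pow_left₀ (Real.rpow_nonneg (X.pn_nonneg n o o) _) hn.le n
  rwa [one_div, Real.rpow_inv_natCast_pow (X.pn_nonneg _ _ _) h0] at this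

/-! ### Self-adjointness of P and the bound of its norm by ρ -/

section Operator

variable [Countable V] [MeasurableSpace V] [DiscreteMeasurableSpace V] {o : V}

omit [Countable V] [DiscreteMeasurableSpace V] in
theorem L2_ext {f g : X.L2 o} (h : ∀ x, (f : V → ℂ) x = g x) : f = g :=
  Lp.ext (ae_of_all _ h)

theorem toLp_apply {f : V → ℂ} (hf : MemLp f 2 (X.meas o)) (x : V) :
    (hf.toLp f : V → ℂ) x = f x :=
  congrFun (X.eq_of_ae hf.coeFn_toLp) x

@[simp] theorem sub_apply (f g : X.L2 o) (x : V) : ((f - g : X.L2 o) : V → ℂ) x = f x - g x :=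
  congrFun (X.eq_of_ae (Lp.coeFn_sub f g)) x

@[simp] theorem smul_apply (c : ℂ) (f : X.L2 o) (x : V) :
    ((c • f : X.L2 o) : V → ℂ) x = c * f x :=
  congrFun (X.eq_of_ae (Lp.coeFn_smul c f)) x

theorem op_apply (f : X.L2 o) (x : V) : (X.op o f : V → ℂ) x = ∑' y, (X.p x y : ℂ) * f y :=
  X.toLp_apply (X.memLp_act (Lp.memLp f)) x

open Classical in
theorem delta_apply (x y : V) : (X.delta o y : V → ℂ) x = if x = y then 1 else 0 := by
  have h := congrFun (X.eq_of_ae (indicatorConstLp_coeFn (p := 2) (hs := measurableSet_singleton y)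
    (hμs := show X.meas o {y} ≠ ∞ by rw [X.meas_singleton]; exact ENNReal.ofReal_ne_top)
    (c := (1 : ℂ)))) x
  rw [delta, h]
  simp [Set.indicator_apply]

theorem inner_delta (x : V) (f : X.L2 o) : inner ℂ (X.delta o x) f = (X.mass o x : ℂ) * f x := by
  rw [delta, L2.inner_indicatorConstLp_one, integral_singleton]
  simp [Measure.real, X.meas_singleton, ENNReal.toReal_ofReal (X.mass_pos o x).le]

omit [Countable V] [DiscreteMeasurableSpace V] in
theorem norm_sq_eq_of_inner {f : X.L2 o} {r : ℝ} (h : inner ℂ f f = (r : ℂ)) : ‖f‖ ^ 2 = r := by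
  rw [← inner_self_eq_norm_sq (𝕜 := ℂ), h]
  rfl

theorem norm_delta_sq (x : V) : ‖X.delta o x‖ ^ 2 = X.mass o x := by
  refine X.norm_sq_eq_of_inner ?_
  rw [inner_delta, delta_apply, if_pos rfl, mul_one]

theorem eq_of_inner_delta {f g : X.L2 o}
    (h : ∀ x, inner ℂ (X.delta o x) f = inner ℂ (X.delta o x) g) : f = g :=
  X.L2_ext fun x => by
    have := h x
    rw [inner_delta, inner_delta] at this
    exact mul_left_cancel₀ (by exact_mod_cast (X.mass_pos o x).ne') this

theorem dense_span_delta : (Submodule.span ℂ (Set.range (X.delta o))).topologicalClosure = ⊤ := by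
  rw [Submodule.topologicalClosure_eq_top_iff, Submodule.eq_bot_iff]
  intro f hf
  refine X.eq_of_inner_delta fun x => ?_
  rw [inner_zero_right]
  exact Submodule.mem_orthogonal _ _ |>.1 hf _ (Submodule.subset_span ⟨x, rfl⟩)

theorem op_delta_apply (x y : V) : (X.op o (X.delta o y) : V → ℂ) x = X.p x y := by
  rw [op_apply, tsum_eq_single y]
  · simp [delta_apply]
  · intro z hz
    simp [delta_apply, hz]

/-- For f a point mass this is the reversing identity for m. Both sides are continuous and linear in
f, and point masses span a dense subspace; `inner_op` extends the other argument in the same way. -/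
theorem inner_op_delta (x : V) (f : X.L2 o) :
    inner ℂ (X.op o (X.delta o x)) f = inner ℂ (X.delta o x) (X.op o f) := by
  suffices h : (innerSL ℂ (X.op o (X.delta o x))) = (innerSL ℂ (X.delta o x)).comp (X.op o) by
    simpa using congrArg (fun φ => φ f) h
  refine ContinuousLinearMap.ext_on (Submodule.dense_iff_topologicalClosure_eq_top.2
    X.dense_span_delta) ?_
  rintro _ ⟨y, rfl⟩
  simp only [innerSL_apply_apply, ContinuousLinearMap.comp_apply, inner_delta, op_delta_apply]
  rw [← inner_conj_symm, inner_delta, op_delta_apply]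
  have := X.reversible o x y
  simp only [map_mul, Complex.conj_ofReal]
  exact_mod_cast this.symm

theorem inner_op (f g : X.L2 o) : inner ℂ (X.op o f) g = inner ℂ f (X.op o g) := by
  rw [← inner_conj_symm, ← inner_conj_symm f]
  congr 1
  suffices h : (innerSL ℂ g).comp (X.op o) = innerSL ℂ (X.op o g) by
    simpa using congrArg (fun φ => φ f) h
  refine ContinuousLinearMap.ext_on (Submodule.dense_iff_topologicalClosure_eq_top.2
    X.dense_span_delta) ?_
  rintro _ ⟨y, rfl⟩
  simp only [innerSL_apply_apply, ContinuousLinearMap.comp_apply]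
  rw [← inner_conj_symm, X.inner_op_delta, inner_conj_symm]

theorem inner_op_pow (n : ℕ) (f g : X.L2 o) :
    inner ℂ ((X.op o ^ n) f) g = inner ℂ f ((X.op o ^ n) g) := by
  induction n generalizing f with
  | zero => simp
  | succ n ih =>
    rw [pow_succ, mul_apply_eq_comp, ih, X.inner_op, ← mul_apply_eq_comp,
      ← pow_succ', pow_succ]

theorem op_pow_delta_apply (n : ℕ) (x y : V) :
    ((X.op o ^ n) (X.delta o y) : V → ℂ) x = X.pn n x y := by
  induction n generalizing x with
  | zero => simp [delta_apply, pn, apply_ite ((↑) : ℝ → ℂ)]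
  | succ n ih =>
    rw [pow_succ', mul_apply_eq_comp, op_apply, pn, Complex.ofReal_tsum]
    exact tsum_congr fun z => by rw [ih, Complex.ofReal_mul]

theorem norm_op_pow_delta_sq (n : ℕ) (x : V) :
    ‖(X.op o ^ n) (X.delta o x)‖ ^ 2 = X.mass o x * X.pn (2 * n) x x := by
  refine X.norm_sq_eq_of_inner ?_
  rw [inner_op_pow, ← mul_apply_eq_comp, ← pow_add, ← two_mul, inner_delta,
    op_pow_delta_apply, Complex.ofReal_mul]

/-- Induction by squaring: self-adjointness and Cauchy–Schwarz give ‖Pⁿf‖² = ⟨f, P²ⁿf⟩ ≤ ‖f‖ ‖P²ⁿf‖.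
-/
theorem norm_op_apply_pow_le (f : X.L2 o) (k : ℕ) :
    ‖X.op o f‖ ^ 2 ^ k ≤ ‖(X.op o ^ 2 ^ k) f‖ * ‖f‖ ^ (2 ^ k - 1) := by
  induction k with
  | zero => simp
  | succ k ih =>
    have h1 : ‖(X.op o ^ 2 ^ k) f‖ ^ 2 ≤ ‖f‖ * ‖(X.op o ^ 2 ^ (k + 1)) f‖ := by
      have h := inner_self_eq_norm_sq_to_K (𝕜 := ℂ) ((X.op o ^ 2 ^ k) f)
      rw [inner_op_pow, ← mul_apply_eq_comp, ← pow_add, ← two_mul, ← pow_succ'] at h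
      have h2 := norm_inner_le_norm (𝕜 := ℂ) f ((X.op o ^ 2 ^ (k + 1)) f)
      rw [h] at h2
      simpa using h2
    have h3 : 2 ^ (k + 1) - 1 = (2 ^ k - 1) * 2 + 1 := by
      have := Nat.one_le_two_pow (n := k)
      rw [pow_succ]; omega
    calc ‖X.op o f‖ ^ 2 ^ (k + 1) = (‖X.op o f‖ ^ 2 ^ k) ^ 2 := by rw [← pow_mul, pow_succ]
      _ ≤ (‖(X.op o ^ 2 ^ k) f‖ * ‖f‖ ^ (2 ^ k - 1)) ^ 2 := by gcongr
      _ = ‖(X.op o ^ 2 ^ k) f‖ ^ 2 * ‖f‖ ^ ((2 ^ k - 1) * 2) := by rw [mul_pow, ← pow_mul]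
      _ ≤ ‖f‖ * ‖(X.op o ^ 2 ^ (k + 1)) f‖ * ‖f‖ ^ ((2 ^ k - 1) * 2) := by gcongr
      _ = _ := by rw [h3, pow_succ]; ring

/-- For a point mass ‖Pⁿδ‖² is a multiple of a return probability in 2n steps, which by transitivity
is the same at every vertex. Finite combinations only change the constant C, which does not depend
on n. -/
theorem exists_norm_op_pow_le {Γ : Subgroup (T ≃g T)} (htrans : Transitive Γ)
    (hinv : X.Invariant Γ) {f : X.L2 o} (hf : f ∈ Submodule.span ℂ (Set.range (X.delta o))) :
    ∃ C : ℝ, ∀ n, ‖(X.op o ^ n) f‖ ≤ C * Real.sqrt (X.pn (2 * n) o o) := by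
  induction hf using Submodule.span_induction with
  | mem f hf =>
    obtain ⟨x, rfl⟩ := hf
    obtain ⟨γ, hγ, rfl⟩ := htrans o x
    refine ⟨Real.sqrt (X.mass o (γ o)), fun n => ?_⟩
    rw [← Real.sqrt_mul (X.mass_pos _ _).le, ← X.pn_invariant hinv hγ, ← norm_op_pow_delta_sq,
      Real.sqrt_sq (norm_nonneg _)]
  | zero => exact ⟨0, fun n => by simp⟩
  | add f g _ _ hf hg =>
    obtain ⟨C, hC⟩ := hf
    obtain ⟨D, hD⟩ := hg
    refine ⟨C + D, fun n => ?_⟩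
    rw [map_add, add_mul]
    exact (norm_add_le _ _).trans (add_le_add (hC n) (hD n))
  | smul c f _ hf =>
    obtain ⟨C, hC⟩ := hf
    refine ⟨‖c‖ * C, fun n => ?_⟩
    rw [map_smul, norm_smul, mul_assoc]
    exact mul_le_mul_of_nonneg_left (hC n) (norm_nonneg c)

/-- On finitely supported f, the previous two lemmas bound ‖Pf‖ to the power 2ᵏ by a constant times
(s‖f‖) to the power 2ᵏ, for infinitely many k and any s > ρ. The constant disappears in the limit,
and density does the rest. -/
theorem norm_op_le {Γ : Subgroup (T ≃g T)} (htrans : Transitive Γ) (hinv : X.Invariant Γ) :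
    ‖X.op o‖ ≤ X.rho o := by
  refine le_of_forall_gt_imp_ge_of_dense fun s hs => ?_
  have hs0 : 0 < s := (X.rho_nonneg o).trans_lt hs
  have hspan : ∀ f ∈ Submodule.span ℂ (Set.range (X.delta o)), ‖X.op o f‖ ≤ s * ‖f‖ := by
    intro f hf
    obtain ⟨C, hC⟩ := X.exists_norm_op_pow_le htrans hinv hf
    rcases eq_or_ne f 0 with rfl | hf0
    · simp
    have hfn : 0 < ‖f‖ := norm_pos_iff.2 hf0
    by_contra! hlt
    have hb : 1 < ‖X.op o f‖ / (s * ‖f‖) := (one_lt_div (by positivity)).2 hlt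
    have h1 : Tendsto (fun k : ℕ => (‖X.op o f‖ / (s * ‖f‖)) ^ 2 ^ k) atTop atTop :=
      (tendsto_pow_atTop_atTop_of_one_lt hb).comp (tendsto_pow_atTop_atTop_of_one_lt one_lt_two)
    have h2 : Tendsto (fun k : ℕ => 2 * 2 ^ k) atTop atTop :=
      Tendsto.const_mul_atTop' two_pos (tendsto_pow_atTop_atTop_of_one_lt one_lt_two)
    obtain ⟨k, hk1, hk2⟩ := ((h1.eventually_gt_atTop (|C| / ‖f‖)).and
      (h2.eventually (X.eventually_pn_le hs))).exists
    have h3 := X.norm_op_apply_pow_le f k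
    have h4 : Real.sqrt (X.pn (2 * 2 ^ k) o o) ≤ s ^ 2 ^ k := by
      rw [Real.sqrt_le_iff]
      exact ⟨by positivity, hk2.trans_eq (by rw [← pow_mul, mul_comm])⟩
    have h5 : ‖X.op o f‖ ^ 2 ^ k ≤ |C| * s ^ 2 ^ k * ‖f‖ ^ (2 ^ k - 1) := by
      refine h3.trans (mul_le_mul_of_nonneg_right ((hC _).trans ?_) (by positivity))
      exact mul_le_mul (le_abs_self C) h4 (Real.sqrt_nonneg _) (abs_nonneg C)
    refine absurd hk1 (not_lt.2 ?_)
    rw [div_pow, mul_pow, div_le_div_iff₀ (by positivity) hfn]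
    calc _ ≤ |C| * s ^ 2 ^ k * ‖f‖ ^ (2 ^ k - 1) * ‖f‖ := by gcongr
      _ = _ := by
        rw [mul_assoc, ← pow_succ, Nat.sub_add_cancel Nat.one_le_two_pow]; ring
  refine ContinuousLinearMap.opNorm_le_bound _ hs0.le fun f => ?_
  have hcl : IsClosed {f : X.L2 o | ‖X.op o f‖ ≤ s * ‖f‖} :=
    isClosed_le (by fun_prop) (by fun_prop)
  have hd := Submodule.dense_iff_topologicalClosure_eq_top.2 (X.dense_span_delta (o := o))
  exact hcl.closure_subset_iff.2 hspan (hd f)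

end Operator
end Walk
end TreeWalk

/-! ### The resolvent and the Green function -/

namespace TreeWalk
namespace Walk

variable {V : Type*} {T : SimpleGraph V} (X : Walk T)

section Operator

variable [Countable V] [MeasurableSpace V] [DiscreteMeasurableSpace V] {o : V}

theorem mem_resolventSet_of_norm_op_lt {z : ℂ} (hz : ‖X.op o‖ < ‖z‖) :
    z ∈ resolventSet ℂ (X.op o) :=
  spectrum.mem_resolventSet_of_norm_lt_mul
    ((mul_le_of_le_one_right (norm_nonneg _) ContinuousLinearMap.norm_id_le).trans_lt hz)

theorem eq_resolvent_iff {z : ℂ} (hz : z ∈ resolventSet ℂ (X.op o)) {f u : X.L2 o} :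
    u = resolvent (X.op o) z f ↔ z • u - X.op o u = f := by
  have hu : IsUnit (algebraMap ℂ (X.L2 o →L[ℂ] X.L2 o) z - X.op o) := hz
  have h1 : ∀ v : X.L2 o, (algebraMap ℂ (X.L2 o →L[ℂ] X.L2 o) z - X.op o) v = z • v - X.op o v :=
    fun v => by simp [Algebra.algebraMap_eq_smul_one]
  rw [← h1]
  constructor
  · rintro rfl
    rw [resolvent, ← mul_apply_eq_comp, Ring.mul_inverse_cancel _ hu]
    rfl
  · rintro rfl
    rw [resolvent, ← mul_apply_eq_comp, Ring.inverse_mul_cancel _ hu]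
    rfl

theorem eq_resolvent {z : ℂ} (hz : z ∈ resolventSet ℂ (X.op o)) {f u : X.L2 o}
    (h : ∀ v, z * u v - ∑' w, (X.p v w : ℂ) * u w = f v) : u = resolvent (X.op o) z f :=
  (X.eq_resolvent_iff hz).2 <| X.L2_ext fun v => by
    rw [sub_apply, smul_apply, op_apply]
    exact h v

theorem resolvent_apply_eq {z : ℂ} (hz : z ∈ resolventSet ℂ (X.op o)) (f : X.L2 o) (v : V) :
    z * (resolvent (X.op o) z f : X.L2 o) v -
      ∑' w, (X.p v w : ℂ) * (resolvent (X.op o) z f : X.L2 o) w = f v := by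
  have h := (X.eq_resolvent_iff hz).1 (rfl : resolvent (X.op o) z f = _)
  have h' := congrArg (fun g : X.L2 o => (g : V → ℂ) v) h
  rwa [sub_apply, smul_apply, op_apply] at h'

open Classical in
theorem green_eq {z : ℂ} (hz : z ∈ resolventSet ℂ (X.op o)) (x v : V) :
    z * X.green o v x z - ∑' w, (X.p v w : ℂ) * X.green o w x z = if v = x then 1 else 0 := by
  rw [← X.delta_apply (o := o)]
  exact X.resolvent_apply_eq hz _ v

theorem summable_mul_green (x v : V) (z : ℂ) :
    Summable fun w => (X.p v w : ℂ) * X.green o w x z :=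
  X.summable_act (Lp.memLp _) v

theorem resolvent_delta_eq (x v : V) (z : ℂ) :
    (resolvent (X.op o) z (X.delta o x) : X.L2 o) v = X.green o v x z := rfl

theorem mass_mul_green (x y : V) (z : ℂ) :
    (X.mass o y : ℂ) * X.green o y x z =
      inner ℂ (X.delta o y) (resolvent (X.op o) z (X.delta o x)) :=
  (X.inner_delta y _).symm

/-- The restriction of an element of `ℓ²` to a set of vertices. -/
noncomputable def restrict (s : Set V) (f : X.L2 o) : X.L2 o :=
  ((Lp.memLp f).indicator (DiscreteMeasurableSpace.forall_measurableSet s)).toLp (s.indicator f)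

theorem restrict_apply (s : Set V) (f : X.L2 o) (v : V) :
    (X.restrict s f : V → ℂ) v = s.indicator f v :=
  X.toLp_apply _ v

/-- Multiplicativity of the Green function, obtained by cutting the tree at an edge. -/
theorem green_cut {z : ℂ} (hz : z ∈ resolventSet ℂ (X.op o)) {x y : V} (hxy : T.Adj x y) :
    X.green o y x z + X.p x y * X.green o y x z ^ 2 =
      X.p y x * X.green o x x z * X.green o y y z := by
  classical
  set S : Set V := {v | (T.deleteEdges {s(x, y)}).Reachable y v} with hS
  have hyS : y ∈ S := SimpleGraph.Reachable.refl _
  have hxS : x ∉ S := fun h =>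
    SimpleGraph.isAcyclic_iff_forall_adj_isBridge.1 X.isTree.isAcyclic hxy h.symm
  -- S is the branch at y after deletion of xy, so the only edge leaving S is the deleted one.
  have hS' : ∀ v w, T.Adj v w → v ∈ S → w ∉ S → v = y ∧ w = x := by
    intro v w hvw hv hw
    have : ¬ (T.deleteEdges {s(x, y)}).Adj v w := fun h => hw (hv.trans h.reachable)
    rw [SimpleGraph.deleteEdges_adj, not_and, not_not] at this
    have h := this hvw
    rw [Set.mem_singleton_iff, Sym2.eq_iff] at h
    rcases h with ⟨rfl, rfl⟩ | h
    · exact absurd hv hxS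
    · exact h
  set g : V → ℂ := fun v => X.green o v x z with hg
  -- This is (z − P) applied to the restriction of g to S: inside S there is no source, and the cut
  -- leaves a lost term p(y,x)g(x) at y and a new term −p(x,y)g(y) at x.
  set c : X.L2 o := ((X.p y x : ℂ) * g x) • X.delta o y - ((X.p x y : ℂ) * g y) • X.delta o x with hc
  have hne : x ≠ y := hxy.ne
  have key : X.restrict S (resolvent (X.op o) z (X.delta o x)) = resolvent (X.op o) z c := by
    refine X.eq_resolvent hz fun v => ?_
    have h1 : ∀ w, (X.p v w : ℂ) * S.indicator g w =
        ((if v ∈ S then 1 else 0) * ((X.p v w : ℂ) * g w) +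
          (if w = y then (if v = x then (X.p x y : ℂ) * g y else 0) else 0)) -
          (if w = x then (if v = y then (X.p y x : ℂ) * g x else 0) else 0) := by
      intro w
      by_cases hvw : T.Adj v w
      · by_cases hv : v ∈ S <;> by_cases hw : w ∈ S
        · have hvx : v ≠ x := fun h => hxS (h ▸ hv)
          have hwx : w ≠ x := fun h => hxS (h ▸ hw)
          simp [hv, hw, hvx, hwx]
        · obtain ⟨rfl, rfl⟩ := hS' v w hvw hv hw
          simp [hv, hw, hne]
        · obtain ⟨rfl, rfl⟩ := hS' w v hvw.symm hw hv
          simp [hv, hw, hne.symm]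
        · have hvy : v ≠ y := fun h => hv (h ▸ hyS)
          have hwy : w ≠ y := fun h => hw (h ▸ hyS)
          simp [hv, hw, hvy, hwy]
      · have h2 : ¬ (v = x ∧ w = y) := by rintro ⟨rfl, rfl⟩; exact hvw hxy
        have h3 : ¬ (v = y ∧ w = x) := by rintro ⟨rfl, rfl⟩; exact hvw hxy.symm
        rw [X.eq_zero_of_not_adj hvw]
        split_ifs <;> simp_all
    have h4 := X.green_eq hz x v
    have hsum := X.summable_mul_green (o := o) x v z
    simp only [restrict_apply]
    have h5 : ∑' w, (X.p v w : ℂ) * S.indicator g w =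
        ((if v ∈ S then 1 else 0) * (∑' w, (X.p v w : ℂ) * g w) +
          (if v = x then (X.p x y : ℂ) * g y else 0)) -
          (if v = y then (X.p y x : ℂ) * g x else 0) := by
      have s1 : HasSum (fun w => if w = y then (if v = x then (X.p x y : ℂ) * g y else 0) else 0)
        (if v = x then (X.p x y : ℂ) * g y else 0) := hasSum_ite_eq y _
      have s2 : HasSum (fun w => if w = x then (if v = y then (X.p y x : ℂ) * g x else 0) else 0)
        (if v = y then (X.p y x : ℂ) * g x else 0) := hasSum_ite_eq x _
      rw [← (((hsum.hasSum.mul_left (if v ∈ S then 1 else 0)).add s1).sub s2).tsum_eq]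
      exact tsum_congr h1
    have h6 : ∑' w, (X.p v w : ℂ) * g w = z * g v - if v = x then 1 else 0 := by
      rw [← h4]; ring
    change z * S.indicator g v - ∑' w, (X.p v w : ℂ) * S.indicator g w = _
    rw [h5, h6, hc]
    simp only [sub_apply, smul_apply, delta_apply]
    by_cases hv : v ∈ S
    · have hvx : v ≠ x := fun h => hxS (h ▸ hv)
      simp [hv, hvx]
    · have hvy : v ≠ y := fun h => hv (h ▸ hyS)
      simp [hv, hvy]
  have h7 := congrArg (fun f : X.L2 o => (f : V → ℂ) y) key
  simp only [restrict_apply, hc, map_sub, map_smul, sub_apply, smul_apply,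
    Set.indicator_of_mem hyS, resolvent_delta_eq] at h7
  rw [hg] at h7
  linear_combination h7

/-- The even and odd parts of the Green function. -/
theorem exists_green_parts {z : ℂ} (hz : z ∈ resolventSet ℂ (X.op o)) (x : V) :
    ∃ e q : X.L2 o, X.op o e = z • q ∧ X.op o q = z • e - X.delta o x ∧
      (e : V → ℂ) x = X.green o x x z := by
  classical
  set g : V → ℂ := fun v => X.green o v x z with hg
  -- Neighbours have distances to x of opposite parity, so P exchanges functions supported on E and
  -- on its complement.
  set E : Set V := {v | Even (T.dist x v)} with hE
  have hxE : x ∈ E := by simp [hE]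
  have hadj : ∀ v w, T.Adj v w → (w ∈ E ↔ v ∉ E) := by
    intro v w hvw
    simp only [hE, Set.mem_ofPred_eq, Nat.even_iff]
    rcases X.isTree.dist_eq_dist_add_one_of_adj x hvw with h | h <;> omega
  have hmul : ∀ v w, (X.p v w : ℂ) * E.indicator g w = Eᶜ.indicator 1 v * ((X.p v w : ℂ) * g w) ∧
      (X.p v w : ℂ) * Eᶜ.indicator g w = E.indicator 1 v * ((X.p v w : ℂ) * g w) := by
    intro v w
    by_cases hvw : T.Adj v w
    · have := hadj v w hvw
      by_cases hv : v ∈ E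
      · simp [hv, this]
      · simp [hv, this]
    · simp [X.eq_zero_of_not_adj hvw]
  have h4 := fun v => X.green_eq hz x v
  refine ⟨X.restrict E (resolvent (X.op o) z (X.delta o x)),
    X.restrict Eᶜ (resolvent (X.op o) z (X.delta o x)), X.L2_ext fun v => ?_,
    X.L2_ext fun v => ?_, ?_⟩
  · simp only [op_apply, restrict_apply, smul_apply]
    change ∑' w, (X.p v w : ℂ) * E.indicator g w = z * Eᶜ.indicator g v
    simp only [(hmul v _).1, tsum_mul_left]
    by_cases hv : v ∈ E
    · simp [hv]
    · have hvx : v ≠ x := fun h => hv (h ▸ hxE)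
      have := h4 v
      rw [if_neg hvx, sub_eq_zero] at this
      simpa [hv] using this.symm
  · simp only [op_apply, restrict_apply, smul_apply, sub_apply, delta_apply]
    change ∑' w, (X.p v w : ℂ) * Eᶜ.indicator g w = z * E.indicator g v - _
    simp only [(hmul v _).2, tsum_mul_left]
    by_cases hv : v ∈ E
    · rw [← h4 v]
      simp [hv, hg]
    · have hvx : v ≠ x := fun h => hv (h ▸ hxE)
      simp [hv, hvx]
  · rw [restrict_apply, Set.indicator_of_mem hxE]
    rfl

/-- With e, q the even and odd parts, pairing δ = ze − Pq with e and moving P across gives m(x)G =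
z̄‖e‖² − z‖q‖². From Pe = zq and ‖P‖ < |z| one gets ‖q‖ < ‖e‖, and the last bound is Cauchy–Schwarz
for δ and e. -/
theorem exists_green_formula {z : ℂ} (hz : ‖X.op o‖ < ‖z‖) (x : V) :
    ∃ a b : ℝ, 0 ≤ b ∧ b < a ∧ X.green o x x z = star z * a - z * b ∧
      ‖X.green o x x z‖ ^ 2 ≤ a := by
  have hres := X.mem_resolventSet_of_norm_op_lt hz
  obtain ⟨e, q, he, hq, hex⟩ := X.exists_green_parts hres x
  have hm := X.mass_pos o x
  have hmC : (X.mass o x : ℂ) ≠ 0 := by exact_mod_cast hm.ne'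
  have hz0 : 0 < ‖z‖ := (norm_nonneg _).trans_lt hz
  have h1 : (X.mass o x : ℂ) * X.green o x x z = star z * (‖e‖ ^ 2 : ℝ) - z * (‖q‖ ^ 2 : ℝ) := by
    have hd : X.delta o x = z • e - X.op o q := by rw [hq, sub_sub_cancel]
    rw [← hex, ← X.inner_delta, hd, inner_sub_left, X.inner_op, he, inner_smul_left,
      inner_smul_right, inner_self_eq_norm_sq_to_K, inner_self_eq_norm_sq_to_K]
    push_cast
    rfl
  have he0 : e ≠ 0 := by
    rintro rfl
    rw [map_zero] at he
    rcases smul_eq_zero.1 he.symm with h | rfl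
    · simp [h] at hz0
    · have h2 := X.norm_delta_sq (o := o) x
      rw [map_zero, smul_zero, zero_sub, eq_comm, neg_eq_zero] at hq
      rw [hq] at h2
      simp at h2
      linarith
  have heq : ‖q‖ < ‖e‖ := by
    have h3 : ‖z‖ * ‖q‖ ≤ ‖X.op o‖ * ‖e‖ := by
      rw [← norm_smul, ← he]; exact (X.op o).le_opNorm e
    have h4 : ‖X.op o‖ * ‖e‖ < ‖z‖ * ‖e‖ := mul_lt_mul_of_pos_right hz (norm_pos_iff.2 he0)
    exact lt_of_mul_lt_mul_left (h3.trans_lt h4) hz0.le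
  refine ⟨‖e‖ ^ 2 / X.mass o x, ‖q‖ ^ 2 / X.mass o x, by positivity, ?_, ?_, ?_⟩
  · gcongr
  · refine mul_left_cancel₀ hmC ?_
    rw [h1]
    push_cast
    field_simp
  · have h5 := norm_inner_le_norm (𝕜 := ℂ) (X.delta o x) e
    rw [X.inner_delta, hex, norm_mul, Complex.norm_real, Real.norm_of_nonneg hm.le] at h5
    have h6 := pow_le_pow_left₀ (by positivity) h5 2
    rw [mul_pow, mul_pow, X.norm_delta_sq] at h6
    rw [le_div_iff₀ hm]
    refine le_of_mul_le_mul_left ?_ hm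
    linarith

theorem hasSum_green {z : ℂ} (hz : ‖X.op o‖ < ‖z‖) (x y : V) :
    HasSum (fun n => (z⁻¹) ^ (n + 1) * (X.pn n x y : ℂ)) (X.green o x y z) := by
  have hres := X.mem_resolventSet_of_norm_op_lt hz
  have hz0 : 0 < ‖z‖ := (norm_nonneg _).trans_lt hz
  have hzne : z ≠ 0 := norm_pos_iff.1 hz0
  have ha : ‖z⁻¹ • X.op o‖ < 1 := by
    rw [norm_smul, norm_inv, inv_mul_lt_one₀ hz0]
    exact hz
  have hs := (summable_geometric_of_norm_lt_one ha).hasSum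
  set u : X.L2 o →L[ℂ] X.L2 o := ∑' n, (z⁻¹ • X.op o) ^ n
  have hu : (1 - z⁻¹ • X.op o) * u = 1 := mul_neg_geom_series _ ha
  have hres' : z⁻¹ • u (X.delta o y) = resolvent (X.op o) z (X.delta o y) := by
    rw [X.eq_resolvent_iff hres, smul_inv_smul₀ hzne, map_smul]
    simpa using congrArg (fun A : X.L2 o →L[ℂ] X.L2 o => A (X.delta o y)) hu
  have hmC : (X.mass o x : ℂ) ≠ 0 := by exact_mod_cast (X.mass_pos o x).ne'
  have h1 := ((hs.mapL (ContinuousLinearMap.apply ℂ (X.L2 o) (X.delta o y))).mapL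
    (innerSL ℂ (X.delta o x))).mul_left ((X.mass o x : ℂ)⁻¹ * z⁻¹)
  simp only [ContinuousLinearMap.apply_apply, innerSL_apply_apply, smul_pow, inner_delta] at h1
  have e2 : (X.mass o x : ℂ)⁻¹ * z⁻¹ * (X.mass o x * (u (X.delta o y) : X.L2 o) x) =
      X.green o x y z := by
    rw [← resolvent_delta_eq, ← hres', smul_apply]
    field_simp
  rw [e2] at h1
  refine Eq.mpr (congrArg (fun f => HasSum f _) (funext fun n => ?_)) h1
  rw [_root_.smul_apply, smul_apply, op_pow_delta_apply, pow_succ]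
  field_simp

/-- The weight m depends on the root and need not be Γ-invariant, so the symmetry is read off the
Neumann series, whose coefficients are return probabilities. -/
theorem green_diag_const {Γ : Subgroup (T ≃g T)} (htrans : Transitive Γ)
    (hinv : X.Invariant Γ) {z : ℂ} (hz : ‖X.op o‖ < ‖z‖) (x y : V) :
    X.green o x x z = X.green o y y z := by
  obtain ⟨γ, hγ, rfl⟩ := htrans y x
  refine (X.hasSum_green hz _ _).unique ?_
  simpa only [X.pn_invariant hinv hγ] using X.hasSum_green hz y y

end Operator
end Walk
end TreeWalk

/-! ### Real calculus of sums of square roots -/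

namespace TreeWalk

section Calculus

variable {ι : Type*} {a : ι → ℝ}

/-- The sum `1 + ∑ (√(1 + 4 aᵢ t²) - 1) / 2`. -/
noncomputable def sqrtSum (a : ι → ℝ) (t : ℝ) : ℝ :=
  1 + ∑' i, (Real.sqrt (1 + 4 * a i * t ^ 2) - 1) / 2

theorem one_le_sqrt_one_add {b : ℝ} (hb : 0 ≤ b) (t : ℝ) : 1 ≤ Real.sqrt (1 + 4 * b * t ^ 2) := by
  rw [Real.one_le_sqrt]
  have : 0 ≤ 4 * b * t ^ 2 := by positivity
  linarith

theorem sq_sqrt_one_add {b : ℝ} (hb : 0 ≤ b) (t : ℝ) :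
    Real.sqrt (1 + 4 * b * t ^ 2) ^ 2 = 1 + 4 * b * t ^ 2 :=
  Real.sq_sqrt (by positivity)

theorem hasDerivAt_sqrt_one_add {b : ℝ} (hb : 0 ≤ b) (t : ℝ) :
    HasDerivAt (fun t => (Real.sqrt (1 + 4 * b * t ^ 2) - 1) / 2)
      (2 * b * t / Real.sqrt (1 + 4 * b * t ^ 2)) t := by
  have h0 : 1 + 4 * b * t ^ 2 ≠ 0 := by positivity
  have h1 : HasDerivAt (fun t : ℝ => 1 + 4 * b * t ^ 2) (4 * b * (2 * t)) t := by
    simpa using ((hasDerivAt_pow 2 t).const_mul (4 * b)).const_add 1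
  refine (((h1.sqrt h0).sub_const 1).div_const 2).congr_deriv ?_
  field_simp
  ring

theorem abs_deriv_sqrt_one_add_le {b : ℝ} (hb : 0 ≤ b) {t R : ℝ} (ht : |t| ≤ R) :
    |2 * b * t / Real.sqrt (1 + 4 * b * t ^ 2)| ≤ 2 * R * b := by
  have h1 := one_le_sqrt_one_add hb t
  rw [abs_div, abs_of_pos (one_pos.trans_le h1)]
  refine (div_le_self (abs_nonneg _) h1).trans ?_
  rw [abs_mul, abs_of_nonneg (by positivity : 0 ≤ 2 * b)]
  nlinarith

theorem summable_deriv_sqrt_one_add (ha : ∀ i, 0 ≤ a i) (hs : Summable a) (t : ℝ) :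
    Summable fun i => 2 * a i * t / Real.sqrt (1 + 4 * a i * t ^ 2) :=
  .of_norm_bounded (hs.mul_left (2 * |t|)) fun i => abs_deriv_sqrt_one_add_le (ha i) le_rfl

theorem summable_sqrt_one_add (ha : ∀ i, 0 ≤ a i) (hs : Summable a) (t : ℝ) :
    Summable fun i => (Real.sqrt (1 + 4 * a i * t ^ 2) - 1) / 2 := by
  refine .of_nonneg_of_le (fun i => ?_) (fun i => ?_) (hs.mul_left (2 * t ^ 2))
  · have := one_le_sqrt_one_add (ha i) t
    linarith
  · nlinarith [one_le_sqrt_one_add (ha i) t, sq_sqrt_one_add (ha i) t]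

theorem hasDerivAt_sqrtSum (ha : ∀ i, 0 ≤ a i) (hs : Summable a) (t : ℝ) :
    HasDerivAt (sqrtSum a) (∑' i, 2 * a i * t / Real.sqrt (1 + 4 * a i * t ^ 2)) t := by
  refine HasDerivAt.const_add 1 ?_
  -- The bounded ball around 0 containing t gives a summable bound on the derivatives that is
  -- uniform in the point.
  refine hasDerivAt_tsum_of_isPreconnected (t := Metric.ball 0 (|t| + 1)) (y₀ := t)
    (hs.mul_left (2 * (|t| + 1))) Metric.isOpen_ball (convex_ball 0 _).isPreconnected
    (fun i s _ => hasDerivAt_sqrt_one_add (ha i) s) (fun i s hs => ?_) (by simp)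
    (summable_sqrt_one_add ha hs t) (by simp)
  exact abs_deriv_sqrt_one_add_le (ha i) (mem_ball_zero_iff.1 hs).le

/-- The sum `∑ (1 - 1 / √(1 + 4 aᵢ t²)) / 2`. -/
noncomputable def defectSum (a : ι → ℝ) (t : ℝ) : ℝ :=
  ∑' i, (1 - 1 / Real.sqrt (1 + 4 * a i * t ^ 2)) / 2

theorem defect_nonneg {b : ℝ} (hb : 0 ≤ b) (t : ℝ) :
    0 ≤ (1 - 1 / Real.sqrt (1 + 4 * b * t ^ 2)) / 2 := by
  have h := one_le_sqrt_one_add hb t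
  have : 1 / Real.sqrt (1 + 4 * b * t ^ 2) ≤ 1 := (div_le_one (one_pos.trans_le h)).2 h
  linarith

theorem defect_le {b : ℝ} (hb : 0 ≤ b) (t : ℝ) :
    (1 - 1 / Real.sqrt (1 + 4 * b * t ^ 2)) / 2 ≤ 2 * t ^ 2 * b := by
  have h := one_le_sqrt_one_add hb t
  have h2 := sq_sqrt_one_add hb t
  set S := Real.sqrt (1 + 4 * b * t ^ 2)
  have hS : 0 < S := one_pos.trans_le h
  have : 1 - 1 / S ≤ S - 1 := by
    rw [sub_le_iff_le_add, ← sub_le_iff_le_add', le_div_iff₀ hS]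
    nlinarith [sq_nonneg (S - 1)]
  nlinarith

theorem summable_defect (ha : ∀ i, 0 ≤ a i) (hs : Summable a) (t : ℝ) :
    Summable fun i => (1 - 1 / Real.sqrt (1 + 4 * a i * t ^ 2)) / 2 :=
  .of_nonneg_of_le (fun i => defect_nonneg (ha i) t) (fun i => defect_le (ha i) t)
    (hs.mul_left (2 * t ^ 2))

/-- Termwise, with S the square root, 4at² = S² − 1 turns (S − 1)/2 − 2at²/S into −(1 − 1/S)/2. The
equation for θ thus becomes `defectSum a θ = 1`. -/
theorem sqrtSum_sub (ha : ∀ i, 0 ≤ a i) (hs : Summable a) (t : ℝ) :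
    sqrtSum a t - t * ∑' i, 2 * a i * t / Real.sqrt (1 + 4 * a i * t ^ 2) = 1 - defectSum a t := by
  rw [sqrtSum, defectSum, ← tsum_mul_left, add_sub_assoc, sub_eq_add_neg 1 (tsum _), ← tsum_neg,
    ← (summable_sqrt_one_add ha hs t).tsum_sub ((summable_deriv_sqrt_one_add ha hs t).mul_left t)]
  congr 1
  refine tsum_congr fun i => ?_
  have h := one_pos.trans_le (one_le_sqrt_one_add (ha i) t)
  have h2 := sq_sqrt_one_add (ha i) t
  set S := Real.sqrt (1 + 4 * a i * t ^ 2)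
  field_simp
  linear_combination h2

theorem continuousOn_defectSum (ha : ∀ i, 0 ≤ a i) (hs : Summable a) (R : ℝ) :
    ContinuousOn (defectSum a) (Set.Icc 0 R) := by
  refine continuousOn_tsum (fun i => ?_) (hs.mul_left (2 * R ^ 2)) fun i t ht => ?_
  · intro t _
    have h := (one_pos.trans_le (one_le_sqrt_one_add (ha i) t)).ne'
    refine ContinuousAt.continuousWithinAt ?_
    fun_prop (disch := assumption)
  · rw [Real.norm_of_nonneg (defect_nonneg (ha i) t)]
    refine (defect_le (ha i) t).trans ?_
    have := ha i
    have := ht.1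
    have := ht.2
    gcongr

theorem defect_lt {b : ℝ} (hb : 0 < b) {s t : ℝ} (hs : 0 ≤ s) (hst : s < t) :
    (1 - 1 / Real.sqrt (1 + 4 * b * s ^ 2)) / 2 < (1 - 1 / Real.sqrt (1 + 4 * b * t ^ 2)) / 2 := by
  have h := one_pos.trans_le (one_le_sqrt_one_add hb.le s)
  have h2 : Real.sqrt (1 + 4 * b * s ^ 2) < Real.sqrt (1 + 4 * b * t ^ 2) :=
    Real.sqrt_lt_sqrt (by positivity) (by gcongr)
  have := one_div_lt_one_div_of_lt h h2
  linarith

theorem defectSum_lt (ha : ∀ i, 0 ≤ a i) (hs : Summable a) {i : ι} (hi : 0 < a i) {s t : ℝ}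
    (h0 : 0 ≤ s) (hst : s < t) : defectSum a s < defectSum a t := by
  refine (summable_defect ha hs s).tsum_lt_tsum (i := i) (fun j => ?_) (defect_lt hi h0 hst)
    (summable_defect ha hs t)
  rcases (ha j).eq_or_lt with h | h
  · simp [← h]
  · exact (defect_lt h h0 hst).le

theorem tendsto_defect {b : ℝ} (hb : 0 < b) :
    Tendsto (fun t => (1 - 1 / Real.sqrt (1 + 4 * b * t ^ 2)) / 2) atTop (nhds (1 / 2)) := by
  have h1 : Tendsto (fun t : ℝ => 1 + 4 * b * t ^ 2) atTop atTop :=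
    tendsto_atTop_add_const_left _ _ ((tendsto_pow_atTop two_ne_zero).const_mul_atTop (by positivity))
  have h2 := (Real.tendsto_sqrt_atTop.comp h1).inv_tendsto_atTop
  have h3 := (h2.const_sub 1).div_const 2
  simpa [Function.comp_def, one_div] using h3

/-- Each term with positive weight tends to 1/2, so three of them already exceed 1; two would only
approach 1. -/
theorem exists_one_lt_defectSum (ha : ∀ i, 0 ≤ a i) (hs : Summable a) {F : Finset ι}
    (hF : 3 ≤ F.card) (hpos : ∀ i ∈ F, 0 < a i) : ∃ t, 0 < t ∧ 1 < defectSum a t := by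
  have h1 : Tendsto (fun t => ∑ i ∈ F, (1 - 1 / Real.sqrt (1 + 4 * a i * t ^ 2)) / 2) atTop
      (nhds (∑ i ∈ F, 1 / 2)) := tendsto_finsetSum _ fun i hi => tendsto_defect (hpos i hi)
  have h2 : (1 : ℝ) < ∑ i ∈ F, 1 / 2 := by
    rw [Finset.sum_const, nsmul_eq_mul]
    have : (3 : ℝ) ≤ F.card := by exact_mod_cast hF
    linarith
  obtain ⟨t, ht0, ht⟩ := ((eventually_gt_atTop 0).and (h1.eventually (lt_mem_nhds h2))).exists
  exact ⟨t, ht0, ht.trans_le ((summable_defect ha hs t).sum_le_tsum F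
    fun i _ => defect_nonneg (ha i) t)⟩

theorem exists_defectSum_eq_one (ha : ∀ i, 0 ≤ a i) (hs : Summable a) {F : Finset ι}
    (hF : 3 ≤ F.card) (hpos : ∀ i ∈ F, 0 < a i) :
    ∃ s, 0 < s ∧ defectSum a s = 1 ∧ ∀ t, 0 < t → defectSum a t = 1 → t = s := by
  obtain ⟨R, hR0, hR⟩ := exists_one_lt_defectSum ha hs hF hpos
  have h0 : defectSum a 0 = 0 := by simp [defectSum]
  obtain ⟨s, hs1, hs2⟩ := intermediate_value_Icc hR0.le (continuousOn_defectSum ha hs R)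
    ⟨by rw [h0]; exact one_pos.le, hR.le⟩
  obtain ⟨i, hi⟩ := Finset.card_pos.1 (by omega : 0 < F.card)
  have hs0 : 0 < s := by
    refine hs1.1.lt_of_ne ?_
    rintro rfl
    rw [h0] at hs2
    exact zero_ne_one hs2
  refine ⟨s, hs0, hs2, fun t ht ht1 => ?_⟩
  rcases lt_trichotomy t s with h | h | h
  · have := defectSum_lt ha hs (hpos i hi) ht.le h
    linarith
  · exact h
  · have := defectSum_lt ha hs (hpos i hi) hs0.le h
    linarith

/-- The graph of the convex function `sqrtSum a` lies above its tangents. -/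
theorem sqrtSum_tangent_le (ha : ∀ i, 0 ≤ a i) (hs : Summable a) (s t : ℝ) :
    sqrtSum a s + (∑' i, 2 * a i * s / Real.sqrt (1 + 4 * a i * s ^ 2)) * (t - s) ≤
      sqrtSum a t := by
  rw [sqrtSum, sqrtSum, ← tsum_mul_right, add_assoc,
    ← (summable_sqrt_one_add ha hs s).tsum_add ((summable_deriv_sqrt_one_add ha hs s).mul_right (t - s))]
  refine add_le_add_right ?_ 1
  refine ((summable_sqrt_one_add ha hs s).add
    ((summable_deriv_sqrt_one_add ha hs s).mul_right (t - s))).tsum_le_tsum (fun i => ?_)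
    (summable_sqrt_one_add ha hs t)
  have hS0 := one_pos.trans_le (one_le_sqrt_one_add (ha i) s)
  have hT0 := one_pos.trans_le (one_le_sqrt_one_add (ha i) t)
  have hS := sq_sqrt_one_add (ha i) s
  have hT := sq_sqrt_one_add (ha i) t
  set S := Real.sqrt (1 + 4 * a i * s ^ 2)
  set U := Real.sqrt (1 + 4 * a i * t ^ 2)
  -- Cauchy–Schwarz for the vectors (1, 2√a s) and (1, 2√a t), of lengths S and U.
  have key : 1 + 4 * a i * s * t ≤ S * U := by
    refine (le_abs_self _).trans (abs_le_of_sq_le_sq ?_ (by positivity))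
    rw [mul_pow, hS, hT]
    nlinarith [mul_nonneg (ha i) (sq_nonneg (s - t))]
  have h1 : (S - 1) / 2 + 2 * a i * s / S * (t - s) = (1 + 4 * a i * s * t) / (2 * S) - 1 / 2 := by
    field_simp
    linear_combination hS
  have h2 : (1 + 4 * a i * s * t) / (2 * S) ≤ U / 2 := by
    rw [div_le_iff₀ (by positivity)]
    linarith
  rw [h1]
  linarith

end Calculus
end TreeWalk

/-! ### Complex square roots, sums over edge types, and the domains 𝒰 and 𝒲 -/

namespace TreeWalk

theorem complexSqrt_sq (a : ℂ) : Complex.sqrt a ^ 2 = a :=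
  Complex.cpow_nat_inv_pow a two_ne_zero

theorem complexSqrt_re_nonneg (a : ℂ) : 0 ≤ (Complex.sqrt a).re := by
  rw [Complex.sqrt, Complex.cpow_inv_two_re]
  exact Real.sqrt_nonneg _

theorem eq_complexSqrt {c a : ℂ} (hc : 0 < c.re) (h : c ^ 2 = a) : c = Complex.sqrt a := by
  rcases sq_eq_sq_iff_eq_or_eq_neg.1 (h.trans (complexSqrt_sq a).symm) with h' | h'
  · exact h'
  · have := complexSqrt_re_nonneg a
    rw [h', Complex.neg_re] at hc
    linarith

theorem complexSqrt_ofReal {x : ℝ} (hx : 0 ≤ x) : Complex.sqrt (x : ℂ) = (Real.sqrt x : ℂ) := by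
  rw [Complex.sqrt_of_nonneg (by exact_mod_cast hx), Complex.ofReal_re]

/-- With c the root, (c − 1)(c + 1) = u, and Re c ≥ 0 forces |c + 1| ≥ 1. -/
theorem norm_complexSqrt_sub_one_le (u : ℂ) : ‖Complex.sqrt (1 + u) - 1‖ ≤ ‖u‖ := by
  set c := Complex.sqrt (1 + u)
  have h : (c - 1) * (c + 1) = u := by
    have := complexSqrt_sq (1 + u)
    linear_combination this
  have h1 : 1 ≤ ‖c + 1‖ := by
    refine le_trans ?_ (Complex.re_le_norm _)
    have : 0 ≤ c.re := complexSqrt_re_nonneg _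
    rw [Complex.add_re, Complex.one_re]
    linarith
  rw [← h, norm_mul]
  exact le_mul_of_one_le_right (norm_nonneg _) h1

variable {V : Type*} {T : SimpleGraph V} {Γ : Subgroup (T ≃g T)}

namespace Walk

variable (X : Walk T) (hinv : X.Invariant Γ)

/-- The weight `p(x,y) p(y,x)` of an edge. -/
noncomputable def weight (x y : V) : ℝ := X.p x y * X.p y x

theorem weight_nonneg (x y : V) : 0 ≤ X.weight x y := mul_nonneg (X.nonneg _ _) (X.nonneg _ _)

theorem weight_le (x y : V) : X.weight x y ≤ X.p x y :=
  mul_le_of_le_one_right (X.nonneg _ _) (X.le_one _ _)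

theorem weight_pos {x y : V} (h : T.Adj x y) : 0 < X.weight x y :=
  mul_pos ((X.pos_iff _ _).2 h) ((X.pos_iff _ _).2 h.symm)

theorem weight_eq_zero {x y : V} (h : ¬ T.Adj x y) : X.weight x y = 0 := by
  rw [weight, X.eq_zero_of_not_adj h, zero_mul]

theorem summable_weight (x : V) : Summable (X.weight x) :=
  .of_nonneg_of_le (X.weight_nonneg x) (X.weight_le x) (X.hasSum_one x).summable

theorem pp_edgeType {x y : V} (h : T.Adj x y) :
    X.pp hinv (edgeType Γ ⟨(x, y), h⟩) = X.weight x y := rfl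

theorem pp_pos (j : EdgeType Γ) : 0 < X.pp hinv j := by
  induction j using Quotient.inductionOn with
  | h d => exact X.weight_pos d.adj

theorem pp_le_one (j : EdgeType Γ) : X.pp hinv j ≤ 1 := by
  induction j using Quotient.inductionOn with
  | h d => exact (X.weight_le d.fst d.snd).trans (X.le_one _ _)

include hinv in
-- Group the neighbours of x by type. On a fibre the transition probability is a positive constant
-- and summable, so the fibre is finite and `ncard` is its true cardinality rather than the default
-- 0.
theorem hasSum_deg_mul {𝕜 : Type*} [RCLike 𝕜] {x : V} {F : EdgeType Γ → 𝕜} {a : 𝕜}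
    (h : HasSum (fun y : {y // T.Adj x y} => F (edgeType Γ ⟨(x, y), y.2⟩)) a) :
    HasSum (fun j => (EdgeType.deg Γ x j : 𝕜) * F j) a := by
  set τ : {y // T.Adj x y} → EdgeType Γ := fun y => edgeType Γ ⟨(x, y), y.2⟩ with hτ
  have h1 := (Equiv.sigmaFiberEquiv τ).hasSum_iff.2 h
  refine h1.sigma fun j => ?_
  have hfin : Finite {y // τ y = j} := by
    by_contra hinf
    rw [not_finite_iff_infinite] at hinf
    have hs : Summable fun y : {y // τ y = j} => X.p x y.1.1 :=
      (X.hasSum_one x).summable.comp_injective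
        (i := fun y : {y // τ y = j} => y.1.1) fun a b hab => Subtype.ext (Subtype.ext hab)
    have hc : ∀ y : {y // τ y = j}, X.p x y.1.1 = X.pType hinv j := fun y =>
      congrArg (X.pType hinv) y.2
    simp only [hc, summable_const_iff] at hs
    obtain ⟨y⟩ := (inferInstance : Nonempty {y // τ y = j})
    have := (X.pos_iff _ _).2 y.1.2
    rw [hc, hs] at this
    exact lt_irrefl _ this
  have : Fintype {y // τ y = j} := Fintype.ofFinite _
  have hcard : EdgeType.deg Γ x j = Fintype.card {y // τ y = j} := by
    rw [EdgeType.deg, ← Nat.card_coe_set_eq, ← Nat.card_eq_fintype_card]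
    exact Nat.card_congr
      { toFun := fun y => ⟨⟨y.1, y.2.1⟩, y.2.2⟩
        invFun := fun y => ⟨y.1.1, y.1.2, y.2⟩
        left_inv := fun _ => rfl
        right_inv := fun _ => rfl }
  have h2 : HasSum (fun _ : {y // τ y = j} => F j) ((EdgeType.deg Γ x j : 𝕜) * F j) := by
    convert! hasSum_fintype (fun _ : {y // τ y = j} => F j) using 1
    rw [Finset.sum_const, nsmul_eq_mul, hcard]
    rfl
  exact Eq.mpr (congrArg (fun f => HasSum f _) (funext fun c => congrArg F c.2)) h2

include hinv in
-- Non-neighbours have weight 0, where F vanishes. Sums over types can therefore be traded for sums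
-- over all vertices, the form in which the calculus is done.
theorem hasSum_deg_mul_pp {𝕜 : Type*} [RCLike 𝕜] {x : V} {F : ℝ → 𝕜} (hF : F 0 = 0) {a : 𝕜}
    (h : HasSum (fun y => F (X.weight x y)) a) :
    HasSum (fun j => (EdgeType.deg Γ x j : 𝕜) * F (X.pp hinv j)) a := by
  refine X.hasSum_deg_mul hinv (F := fun j => F (X.pp hinv j)) ?_
  refine (hasSum_subtype_iff_of_support_subset (s := {y | T.Adj x y}) fun y hy => ?_).2 h
  by_contra hxy
  exact hy (by change F (X.weight x y) = 0; rw [X.weight_eq_zero hxy, hF])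

theorem summable_deg_mul_pp (o : V) :
    Summable fun j => (EdgeType.deg Γ o j : ℝ) * X.pp hinv j :=
  (X.hasSum_deg_mul_pp hinv (F := id) rfl (X.summable_weight o).hasSum).summable

theorem norm_phiTerm_le (o : V) (t : ℂ) (j : EdgeType Γ) :
    ‖X.phiTerm hinv o t j‖ ≤ 2 * ‖t‖ ^ 2 * ((EdgeType.deg Γ o j : ℝ) * X.pp hinv j) := by
  have h := norm_complexSqrt_sub_one_le (4 * (X.pp hinv j : ℂ) * t ^ 2)
  rw [norm_mul, norm_mul, norm_pow, Complex.norm_real,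
    Real.norm_of_nonneg (X.pp_pos hinv j).le] at h
  rw [phiTerm, norm_mul, norm_div]
  norm_num at h ⊢
  calc _ ≤ (EdgeType.deg Γ o j : ℝ) / 2 * (4 * X.pp hinv j * ‖t‖ ^ 2) := by gcongr
    _ = _ := by ring

theorem summable_norm_phiTerm (o : V) (t : ℂ) : Summable fun j => ‖X.phiTerm hinv o t j‖ :=
  .of_nonneg_of_le (fun _ => norm_nonneg _) (X.norm_phiTerm_le hinv o t)
    ((X.summable_deg_mul_pp hinv o).mul_left _)

theorem phi_eq_of_hasSum {o : V} {t a : ℂ}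
    (h : HasSum (fun y => (Complex.sqrt (1 + 4 * (X.weight o y : ℂ) * t ^ 2) - 1) / 2) a) :
    X.Phi hinv o t = 1 + a := by
  have h1 := X.hasSum_deg_mul_pp hinv
    (F := fun w => (Complex.sqrt (1 + 4 * (w : ℂ) * t ^ 2) - 1) / 2) (by simp) h
  rw [Phi, ← h1.tsum_eq]
  congr 1
  exact tsum_congr fun j => by rw [phiTerm]; ring

theorem phiReal_eq (o : V) (t : ℝ) :
    X.PhiReal hinv o t = 1 + ∑' y, (Real.sqrt (1 + 4 * X.weight o y * t ^ 2) - 1) / 2 := by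
  have h1 := X.hasSum_deg_mul_pp hinv (𝕜 := ℝ)
    (F := fun w => (Real.sqrt (1 + 4 * w * t ^ 2) - 1) / 2) (by simp)
    (summable_sqrt_one_add (X.weight_nonneg o) (X.summable_weight o) t).hasSum
  rw [PhiReal, ← h1.tsum_eq]
  congr 1
  exact tsum_congr fun j => by ring

theorem phi_ofReal (o : V) (t : ℝ) : X.Phi hinv o (t : ℂ) = (X.PhiReal hinv o t : ℂ) := by
  rw [Phi, PhiReal, Complex.ofReal_add, Complex.ofReal_one, Complex.ofReal_tsum]
  congr 1
  refine tsum_congr fun j => ?_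
  have h : 0 ≤ 1 + 4 * X.pp hinv j * t ^ 2 := by
    have := X.pp_pos hinv j
    positivity
  rw [phiTerm]
  push_cast
  rw [← complexSqrt_ofReal h]
  push_cast
  rfl

theorem two_sqrt_pp_le_kappa (j : EdgeType Γ) : 2 * Real.sqrt (X.pp hinv j) ≤ X.kappa hinv := by
  refine le_ciSup (f := fun j => 2 * Real.sqrt (X.pp hinv j)) ⟨2, ?_⟩ j
  rintro _ ⟨i, rfl⟩
  have : Real.sqrt (X.pp hinv i) ≤ 1 := Real.sqrt_le_one.2 (X.pp_le_one hinv i)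
  dsimp only
  linarith

theorem kappa_nonneg : 0 ≤ X.kappa hinv := Real.iSup_nonneg fun _ => by positivity

theorem kappa_pos {x y : V} (h : T.Adj x y) : 0 < X.kappa hinv :=
  lt_of_lt_of_le (mul_pos two_pos (Real.sqrt_pos.2 (X.pp_pos hinv (edgeType Γ ⟨(x, y), h⟩))))
    (X.two_sqrt_pp_le_kappa hinv _)

theorem eq_I_mul_or_iff {z : ℂ} {P : ℝ → Prop} (hP : ∀ t, P t → 0 ≤ t) :
    (∃ t : ℝ, P t ∧ (z = Complex.I * t ∨ z = -(Complex.I * t))) ↔ z.re = 0 ∧ P |z.im| := by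
  constructor
  · rintro ⟨t, ht, rfl | rfl⟩ <;> simp [abs_of_nonneg (hP t ht), ht]
  · rintro ⟨h0, h⟩
    refine ⟨_, h, ?_⟩
    rcases abs_choice z.im with h' | h' <;> rw [h']
    · left; apply Complex.ext <;> simp [h0]
    · right; apply Complex.ext <;> simp [h0]

theorem mem_domW_iff {t : ℂ} : t ∈ X.domW hinv ↔ ¬ (t.re = 0 ∧ 1 / X.kappa hinv ≤ |t.im|) := by
  rw [domW, Set.mem_compl_iff, Set.mem_ofPred_eq,
    eq_I_mul_or_iff fun t ht => (one_div_nonneg.2 (X.kappa_nonneg hinv)).trans ht]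

theorem mem_domU_iff {o : V} {z : ℂ} :
    z ∈ X.domU hinv o ↔ X.rho o < ‖z‖ ∧ (z.re = 0 → X.kappa hinv < |z.im|) := by
  rw [domU, Set.mem_sdiff, Set.mem_ofPred_eq, Set.mem_ofPred_eq]
  simp only [← and_assoc]
  rw [eq_I_mul_or_iff (P := fun t => X.rho o < t ∧ t ≤ X.kappa hinv)
    fun t ht => (X.rho_nonneg o).trans ht.1.le]
  refine and_congr_right fun h => ⟨fun h1 h0 => ?_, fun h1 h2 => ?_⟩
  · by_contra! h2
    refine h1 ⟨h0, ?_, h2⟩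
    rwa [← Complex.abs_im_eq_norm.2 h0] at h
  · exact absurd (h1 h2.1) (not_lt.2 h2.2.2)

theorem isOpen_domW : IsOpen (X.domW hinv) := by
  have : X.domW hinv = {t : ℂ | t.re = 0 ∧ 1 / X.kappa hinv ≤ |t.im|}ᶜ :=
    Set.ext fun t => X.mem_domW_iff hinv
  rw [this, isOpen_compl_iff]
  exact (isClosed_eq Complex.continuous_re continuous_const).inter
    (isClosed_le continuous_const (Complex.continuous_im.abs))

/-- If 1 + 4wt² ≤ 0, where w is the weight of j, then t is imaginary with |t| ≥ 1/(2√w) ≥ 1/κ, so t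
lies on a removed slit. -/
theorem mem_slitPlane_of_mem_domW {t : ℂ} (ht : t ∈ X.domW hinv) (j : EdgeType Γ) :
    1 + 4 * (X.pp hinv j : ℂ) * t ^ 2 ∈ Complex.slitPlane := by
  rw [mem_domW_iff] at ht
  by_contra h
  rw [Complex.mem_slitPlane_iff, not_or, not_lt, not_not] at h
  have hpp := X.pp_pos hinv j
  have hre : (1 + 4 * (X.pp hinv j : ℂ) * t ^ 2).re =
      1 + 4 * X.pp hinv j * (t.re ^ 2 - t.im ^ 2) := by
    simp [sq, Complex.mul_re, Complex.mul_im]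
  have him : (1 + 4 * (X.pp hinv j : ℂ) * t ^ 2).im = 8 * X.pp hinv j * (t.re * t.im) := by
    simp [sq, Complex.mul_re, Complex.mul_im]; ring
  rw [hre, him] at h
  have h1 : t.re * t.im = 0 := (mul_eq_zero.1 h.2).resolve_left (by positivity)
  have h2 : t.im ≠ 0 := by
    intro h0
    rw [h0] at h
    nlinarith [mul_nonneg hpp.le (sq_nonneg t.re)]
  have h3 : t.re = 0 := (mul_eq_zero.1 h1).resolve_right h2
  have hs := Real.sqrt_pos.2 hpp
  refine ht ⟨h3, (one_div_le_one_div_of_le (by positivity) (X.two_sqrt_pp_le_kappa hinv j)).trans ?_⟩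
  rw [div_le_iff₀ (by positivity), ← sq_le_sq₀ (by norm_num) (by positivity), mul_pow, mul_pow,
    sq_abs, Real.sq_sqrt hpp.le]
  rw [h3] at h
  linarith [h.1]

theorem analyticOnNhd_phi (o : V) : AnalyticOnNhd ℂ (X.Phi hinv o) (X.domW hinv) := by
  refine DifferentiableOn.analyticOnNhd (fun t ht => ?_) (X.isOpen_domW hinv)
  have hU : IsOpen (X.domW hinv ∩ Metric.ball 0 (‖t‖ + 1)) :=
    (X.isOpen_domW hinv).inter Metric.isOpen_ball
  have h : DifferentiableOn ℂ (fun t => ∑' j, X.phiTerm hinv o t j)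
      (X.domW hinv ∩ Metric.ball 0 (‖t‖ + 1)) := by
    refine Complex.differentiableOn_tsum_of_summable_norm
      ((X.summable_deg_mul_pp hinv o).mul_left (2 * (‖t‖ + 1) ^ 2)) (fun j => ?_) hU ?_
    · intro s hs
      have := X.mem_slitPlane_of_mem_domW hinv hs.1 j
      have h1 : DifferentiableAt ℂ (fun s : ℂ => 1 + 4 * (X.pp hinv j : ℂ) * s ^ 2) s := by fun_prop
      have h2 := (Complex.differentiableAt_sqrt this).comp s h1
      exact ((h2.sub_const 1).const_mul _).differentiableWithinAt
    · intro j s hs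
      refine (X.norm_phiTerm_le hinv o s j).trans ?_
      have h1 : ‖s‖ ≤ ‖t‖ + 1 := (mem_ball_zero_iff.1 hs.2).le
      have := (X.pp_pos hinv j).le
      gcongr
  exact ((h.differentiableAt (hU.mem_nhds ⟨ht, by simp⟩)).const_add 1).differentiableWithinAt

end Walk
end TreeWalk

/-! ### The functional equation on 𝒰 -/

namespace TreeWalk
namespace Walk

variable {V : Type*} {T : SimpleGraph V} {Γ : Subgroup (T ≃g T)} (X : Walk T)
  (hinv : X.Invariant Γ)

theorem smul_mem_domU {o : V} {z : ℂ} (hz : z ∈ X.domU hinv o) {t : ℝ} (ht : 1 ≤ t) :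
    (t : ℂ) * z ∈ X.domU hinv o := by
  rw [mem_domU_iff] at hz ⊢
  have ht0 : 0 < t := one_pos.trans_le ht
  refine ⟨hz.1.trans_le ?_, fun h => (hz.2 ?_).trans_le ?_⟩
  · rw [norm_mul, Complex.norm_real, Real.norm_of_nonneg ht0.le]
    exact le_mul_of_one_le_left (norm_nonneg _) ht
  · rw [Complex.re_ofReal_mul] at h
    exact (mul_eq_zero.1 h).resolve_left ht0.ne'
  · rw [Complex.im_ofReal_mul, abs_mul, abs_of_pos ht0]
    exact le_mul_of_one_le_left (abs_nonneg _) ht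

variable [Countable V] [MeasurableSpace V] [DiscreteMeasurableSpace V] {o : V}

theorem norm_op_lt (htrans : Transitive Γ) {z : ℂ} (hz : z ∈ X.domU hinv o) :
    ‖X.op o‖ < ‖z‖ :=
  (X.norm_op_le htrans hinv).trans_lt ((X.mem_domU_iff hinv).1 hz).1

/-- As Re G = (a − b) Re z with a > b, an imaginary G needs an imaginary z, hence |z| > κ. Then |G|
= |z|(a + b) ≥ |z||G|², so |G| ≤ 1/|z| < 1/κ if G ≠ 0. -/
theorem green_mem_domW (htrans : Transitive Γ) {u v : V} (huv : T.Adj u v) {z : ℂ}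
    (hz : z ∈ X.domU hinv o) (x : V) : X.green o x x z ∈ X.domW hinv := by
  obtain ⟨a, b, hb, hab, hG, hn⟩ := X.exists_green_formula (X.norm_op_lt hinv htrans hz) x
  set G := X.green o x x z
  rw [mem_domW_iff]
  rintro ⟨h0, h1⟩
  have hre : G.re = z.re * (a - b) := by
    rw [hG]; simp; ring
  have him : G.im = -(z.im * (a + b)) := by
    rw [hG]; simp; ring
  have hz0 : z.re = 0 := by
    rw [h0] at hre
    exact (mul_eq_zero.1 hre.symm).resolve_right (sub_pos.2 hab).ne'
  have hk := X.kappa_pos hinv huv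
  have hzi := ((X.mem_domU_iff hinv).1 hz).2 hz0
  rw [← Complex.abs_im_eq_norm.2 h0] at hn
  have h2 : |G.im| = |z.im| * (a + b) := by
    rw [him, abs_neg, abs_mul, abs_of_pos (by linarith : 0 < a + b)]
  have h3 : 0 < |G.im| := (one_div_pos.2 hk).trans_le h1
  have h4 : |z.im| * |G.im| ^ 2 ≤ |G.im| := by
    nth_rewrite 2 [h2]
    gcongr
    linarith
  have h5 : |z.im| * |G.im| ≤ 1 := by
    refine le_of_mul_le_mul_right ?_ h3
    linarith
  rw [div_le_iff₀ hk] at h1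
  nlinarith

theorem continuousAt_green {z : ℂ} (hz : z ∈ resolventSet ℂ (X.op o)) (x y : V) :
    ContinuousAt (X.green o y x) z := by
  have hm : (X.mass o y : ℂ) ≠ 0 := by exact_mod_cast (X.mass_pos o y).ne'
  have h : X.green o y x = fun z => (X.mass o y : ℂ)⁻¹ *
      inner ℂ (X.delta o y) (resolvent (X.op o) z (X.delta o x)) := by
    funext z
    rw [← mass_mul_green, inv_mul_cancel_left₀ hm]
  rw [h]
  have h1 : ContinuousAt (fun z => resolvent (X.op o) z (X.delta o x)) z :=
    (spectrum.hasDerivAt_resolvent_const_left hz).continuousAt.clm_apply continuousAt_const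
  exact continuousAt_const.mul (continuousAt_const.inner h1)

theorem tendsto_green (x y : V) :
    Tendsto (X.green o y x) (Bornology.cobounded ℂ) (nhds 0) := by
  have hm : (X.mass o y : ℂ) ≠ 0 := by exact_mod_cast (X.mass_pos o y).ne'
  have h : X.green o y x = fun z => (X.mass o y : ℂ)⁻¹ *
      innerSL ℂ (X.delta o y)
        (ContinuousLinearMap.apply ℂ (X.L2 o) (X.delta o x) (resolvent (X.op o) z)) := by
    funext z
    rw [innerSL_apply_apply, ContinuousLinearMap.apply_apply, ← mass_mul_green,
      inv_mul_cancel_left₀ hm]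
  have h2 := (((innerSL ℂ (X.delta o y)).comp (ContinuousLinearMap.apply ℂ (X.L2 o)
    (X.delta o x))).continuous.tendsto 0).comp (spectrum.resolvent_tendsto_cobounded (𝕜 := ℂ) (X.op o))
  rw [map_zero] at h2
  have h3 := h2.const_mul (X.mass o y : ℂ)⁻¹
  rw [mul_zero] at h3
  rw [h]
  exact h3

theorem green_adj_sq (htrans : Transitive Γ) {z : ℂ} (hz : z ∈ X.domU hinv o) {x y : V}
    (hxy : T.Adj x y) : (1 + 2 * (X.p x y : ℂ) * X.green o y x z) ^ 2 =
      1 + 4 * (X.weight x y : ℂ) * X.green o x x z ^ 2 := by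
  have hn := X.norm_op_lt hinv htrans hz
  have h1 := X.green_cut (X.mem_resolventSet_of_norm_op_lt hn) hxy
  rw [X.green_diag_const htrans hinv hn y x] at h1
  rw [weight, Complex.ofReal_mul]
  linear_combination 4 * (X.p x y : ℂ) * h1

theorem green_adj_re_ne_zero (htrans : Transitive Γ) {z : ℂ} (hz : z ∈ X.domU hinv o) {x y : V}
    (hxy : T.Adj x y) : (1 + 2 * (X.p x y : ℂ) * X.green o y x z).re ≠ 0 := by
  intro h0
  have h1 := X.mem_slitPlane_of_mem_domW hinv (X.green_mem_domW hinv htrans hxy hz x)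
    (edgeType Γ ⟨(x, y), hxy⟩)
  rw [X.pp_edgeType hinv hxy, ← X.green_adj_sq hinv htrans hz hxy, Complex.mem_slitPlane_iff, sq,
    Complex.mul_re, Complex.mul_im, h0] at h1
  rcases h1 with h1 | h1
  · nlinarith [mul_self_nonneg (1 + 2 * (X.p x y : ℂ) * X.green o y x z).im]
  · simp at h1

/-- 𝒰 is stable under scaling by t ≥ 1, so the real part has no zero along the ray from z to
infinity. Its limit there is 1 because the resolvent vanishes at infinity, and the intermediate
value theorem excludes a negative start. -/
theorem green_adj_re_pos (htrans : Transitive Γ) {z : ℂ} (hz : z ∈ X.domU hinv o) {x y : V}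
    (hxy : T.Adj x y) : 0 < (1 + 2 * (X.p x y : ℂ) * X.green o y x z).re := by
  set c : ℝ → ℝ := fun t => (1 + 2 * (X.p x y : ℂ) * X.green o y x (t * z)).re with hc
  have hz0 : z ≠ 0 := norm_pos_iff.1 ((norm_nonneg _).trans_lt (X.norm_op_lt hinv htrans hz))
  have hcne : ∀ t, 1 ≤ t → c t ≠ 0 := fun t ht =>
    X.green_adj_re_ne_zero hinv htrans (X.smul_mem_domU hinv hz ht) hxy
  have hcont : ContinuousOn c (Set.Ici 1) := by
    intro t ht
    refine ContinuousAt.continuousWithinAt ?_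
    have h1 := X.continuousAt_green (X.mem_resolventSet_of_norm_op_lt
      (X.norm_op_lt hinv htrans (X.smul_mem_domU hinv hz ht))) x y
    have h2 : ContinuousAt (fun t : ℝ => (t : ℂ) * z) t := by fun_prop
    have h3 : ContinuousAt (fun t : ℝ => X.green o y x (t * z)) t :=
      ContinuousAt.comp (f := fun t : ℝ => (t : ℂ) * z) h1 h2
    exact Complex.continuous_re.continuousAt.comp
      (continuousAt_const.add (continuousAt_const.mul h3))
  have hlim : Tendsto c atTop (nhds 1) := by
    have h1 : Tendsto (fun t : ℝ => (t : ℂ) * z) atTop (Bornology.cobounded ℂ) := by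
      rw [← tendsto_norm_atTop_iff_cobounded]
      simp only [norm_mul, Complex.norm_real]
      exact (tendsto_norm_atTop_atTop).atTop_mul_const (norm_pos_iff.2 hz0)
    have h2 := ((X.tendsto_green (o := o) x y).comp h1).const_mul (2 * (X.p x y : ℂ))
    have h3 := (Complex.continuous_re.tendsto _).comp (h2.const_add 1)
    simp only [mul_zero, add_zero, Complex.one_re] at h3
    exact h3
  by_contra! hneg
  have hneg' : c 1 ≤ 0 := by simpa [hc] using hneg
  obtain ⟨s, hs1, hs⟩ := ((eventually_ge_atTop (1 : ℝ)).and
    (hlim.eventually (lt_mem_nhds one_pos))).exists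
  obtain ⟨t, ht, ht0⟩ := intermediate_value_Icc hs1 (hcont.mono Set.Icc_subset_Ici_self)
    ⟨hneg', hs.le⟩
  exact hcne t ht.1 ht0

theorem functional_equation (htrans : Transitive Γ) {z : ℂ} (hz : z ∈ X.domU hinv o) (x : V) :
    z * X.green o x x z = X.Phi hinv o (X.green o x x z) := by
  have hn := X.norm_op_lt hinv htrans hz
  rw [X.green_diag_const htrans hinv hn x o]
  have h1 := X.green_eq (X.mem_resolventSet_of_norm_op_lt hn) o o
  rw [if_pos rfl, sub_eq_iff_eq_add] at h1
  rw [h1]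
  symm
  refine X.phi_eq_of_hasSum hinv ?_
  refine Eq.mpr (congrArg (fun f => HasSum f _) (funext fun y => ?_))
    (X.summable_mul_green o o z).hasSum
  by_cases hy : T.Adj o y
  · rw [← eq_complexSqrt (X.green_adj_re_pos hinv htrans hz hy)
      (X.green_adj_sq hinv htrans hz hy)]
    ring
  · simp [X.weight_eq_zero hy, X.eq_zero_of_not_adj hy]

/-- For real `s > ρ` the Green function is positive. -/
theorem exists_green_eq_ofReal (htrans : Transitive Γ) {s : ℝ} (hs : X.rho o < s) :
    ∃ g : ℝ, 0 < g ∧ s * g = X.PhiReal hinv o g := by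
  have hs0 : 0 < s := (X.rho_nonneg o).trans_lt hs
  have hU : (s : ℂ) ∈ X.domU hinv o := by
    rw [mem_domU_iff, Complex.norm_real, Real.norm_of_nonneg hs0.le, Complex.ofReal_re]
    exact ⟨hs, fun h => absurd h hs0.ne'⟩
  obtain ⟨a, b, hb, hab, hG, -⟩ := X.exists_green_formula (X.norm_op_lt hinv htrans hU) o
  -- For real z = s the formula collapses to s(a − b), which is visibly positive.
  have hG' : X.green o o o s = ((s * (a - b) : ℝ) : ℂ) := by
    rw [hG, Complex.star_def, Complex.conj_ofReal]
    push_cast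
    ring
  have h := X.functional_equation hinv htrans hU o
  rw [hG', phi_ofReal] at h
  exact ⟨_, mul_pos hs0 (sub_pos.2 hab), by exact_mod_cast h⟩

end Walk
end TreeWalk

/-! ### Superharmonic functions and the upper bound for ρ -/

namespace TreeWalk
namespace Walk

variable {V : Type*} {T : SimpleGraph V} {Γ : Subgroup (T ≃g T)} (X : Walk T)
  (hinv : X.Invariant Γ)

/-- The product of `f` over the successive edges of the geodesic from `o` to `x`. -/
noncomputable def geodesicProd (f : V → V → ℝ) (o x : V) : ℝ :=
  ((X.geodesic o x).darts.map fun d => f d.fst d.snd).prod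

theorem isPath_geodesic (x y : V) : (X.geodesic x y).IsPath :=
  (X.isTree.existsUnique_path x y).choose_spec.1

theorem geodesicProd_pos {f : V → V → ℝ} (hf : ∀ x y, T.Adj x y → 0 < f x y) (o x : V) :
    0 < X.geodesicProd f o x := by
  refine List.prod_pos ?_
  intro a ha
  obtain ⟨d, -, rfl⟩ := List.mem_map.1 ha
  exact hf _ _ d.adj

theorem geodesicProd_of_notMem (f : V → V → ℝ) {o x y : V} (h : T.Adj x y)
    (hy : y ∉ (X.geodesic o x).support) :
    X.geodesicProd f o y = X.geodesicProd f o x * f x y := by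
  have h1 := (X.isTree.existsUnique_path o y).choose_spec.2 _
    ((X.isPath_geodesic o x).concat hy h)
  rw [geodesicProd, geodesicProd, geodesic, ← h1]
  simp only [SimpleGraph.Walk.darts_concat, List.concat_eq_append, List.map_append,
    List.prod_append, List.map_cons, List.map_nil, List.prod_cons, List.prod_nil, mul_one]

theorem weight_comm (x y : V) : X.weight x y = X.weight y x := mul_comm _ _

include hinv in
theorem hasSum_weight_of_transitive (htrans : Transitive Γ) (f : ℝ → ℝ) (o x : V) {a : ℝ}
    (h : HasSum (fun y => f (X.weight o y)) a) : HasSum (fun y => f (X.weight x y)) a := by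
  obtain ⟨γ, hγ, rfl⟩ := htrans o x
  rw [← γ.toEquiv.hasSum_iff]
  have : ∀ y, X.weight (γ o) (γ y) = X.weight o y := fun y => by
    rw [weight, weight, hinv γ hγ, hinv γ hγ]
  refine Eq.mpr (congrArg (fun f => HasSum f _) (funext fun y => ?_)) h
  exact congrArg f (this y)

/-- The witness is a product h of edge factors along geodesics from o. It satisfies Ph = (Φ(t)/t)h
away from o and Ph ≤ (Φ(t)/t)h at o, so iteration bounds the return probabilities by powers of
Φ(t)/t. -/
theorem rho_le_phiReal_div (htrans : Transitive Γ) (o : V) {t : ℝ} (ht : 0 < t) :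
    X.rho o ≤ X.PhiReal hinv o t / t := by
  classical
  set S : V → V → ℝ := fun x y => Real.sqrt (1 + 4 * X.weight x y * t ^ 2) with hS
  have hS2 : ∀ x y, S x y ^ 2 = 1 + 4 * X.weight x y * t ^ 2 := fun x y => by
    have := X.weight_nonneg x y
    exact Real.sq_sqrt (by positivity)
  have hScomm : ∀ x y, S x y = S y x := fun x y => by rw [hS]; simp only [X.weight_comm x y]
  have hS1 : ∀ x y, T.Adj x y → 1 < S x y := fun x y h => by
    have := X.weight_pos h
    rw [hS, Real.lt_sqrt one_pos.le]
    have : 0 < 4 * X.weight x y * t ^ 2 := by positivity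
    linarith
  -- This imitates G(y,o)/G(x,o) on an outward edge, with t in the role of the diagonal value and
  -- the quadratic equation solved by its positive root.
  set f : V → V → ℝ := fun x y => (S x y - 1) / (2 * X.p x y * t) with hf
  have hfpos : ∀ x y, T.Adj x y → 0 < f x y := fun x y h =>
    div_pos (sub_pos.2 (hS1 x y h)) (mul_pos (mul_pos two_pos ((X.pos_iff _ _).2 h)) ht)
  set h := X.geodesicProd f o
  have hpos : ∀ x, 0 < h x := X.geodesicProd_pos hfpos o
  have hout : ∀ x y, T.Adj x y → X.p x y * f x y = (S x y - 1) / 2 / t := fun x y hxy => by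
    have := ((X.pos_iff _ _).2 hxy).ne'
    rw [hf]; field_simp
  -- Since (S − 1)(S + 1) = 4p(x,y)p(y,x)t², the step back towards o contributes (S + 1)/(2t),
  -- exactly 1/t more than an outward step.
  have hin : ∀ x y, T.Adj x y → X.p x y = f y x * ((S x y - 1) / 2 / t + 1 / t) := by
    intro x y hxy
    have h1 := ((X.pos_iff _ _).2 hxy.symm).ne'
    have h2 := hS2 x y
    rw [weight] at h2
    rw [hf]
    simp only [hScomm y x]
    field_simp
    linear_combination (-h2)
  have hsum0 : HasSum (fun y => (S o y - 1) / 2) (X.PhiReal hinv o t - 1) := by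
    rw [phiReal_eq, add_sub_cancel_left]
    exact (summable_sqrt_one_add (X.weight_nonneg o) (X.summable_weight o) t).hasSum
  have hsumx : ∀ x, HasSum (fun y => (S x y - 1) / 2 / t) ((X.PhiReal hinv o t - 1) / t) :=
    fun x => (X.hasSum_weight_of_transitive hinv htrans
      (fun w => (Real.sqrt (1 + 4 * w * t ^ 2) - 1) / 2) o x hsum0).div_const t
  have hzero : ∀ x y, ¬ T.Adj x y → (S x y - 1) / 2 / t = 0 := fun x y hxy => by
    rw [hS]; simp [X.weight_eq_zero hxy]
  have key : ∀ x, ∃ a, HasSum (fun y => X.p x y * h y) a ∧ a ≤ X.PhiReal hinv o t / t * h x := by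
    intro x
    -- A neighbour on the geodesic is its penultimate vertex, hence unique, and supplies the extra
    -- 1/t that turns (Φ(t) − 1)/t into Φ(t)/t. With no such neighbour the smaller factor remains.
    by_cases hx : ∃ y, T.Adj x y ∧ y ∈ (X.geodesic o x).support
    · obtain ⟨y, hxy, hy⟩ := hx
      refine ⟨_, ?_, le_refl _⟩
      have h1 := ((hsumx x).add (hasSum_ite_eq y (1 / t))).mul_right (h x)
      rw [← add_div, sub_add_cancel] at h1
      refine Eq.mpr (congrArg (fun f => HasSum f _) (funext fun w => ?_)) h1
      by_cases hxw : T.Adj x w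
      · by_cases hw : w = y
        · subst hw
          rw [if_pos rfl, hin x w hxw]
          have hx' : x ∉ (X.geodesic o w).support :=
            X.isTree.isAcyclic.ne_mem_support_of_support_of_adj_of_isPath
              (X.isPath_geodesic o x) (X.isPath_geodesic o w) hxy hy
          have h2 : h x = h w * f w x := X.geodesicProd_of_notMem f hxy.symm hx'
          rw [h2]; ring
        · have hw' : w ∉ (X.geodesic o x).support := fun hw' => hw <|
            (X.isTree.isAcyclic.eq_penultimate_of_adj_end (X.isPath_geodesic o x) hxw hw').trans
            (X.isTree.isAcyclic.eq_penultimate_of_adj_end (X.isPath_geodesic o x) hxy hy).symm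
          have h2 : h w = h x * f x w := X.geodesicProd_of_notMem f hxw hw'
          rw [if_neg hw, h2, ← hout x w hxw]; ring
      · have hw : w ≠ y := fun hw => hxw (hw ▸ hxy)
        rw [X.eq_zero_of_not_adj hxw, hzero x w hxw, if_neg hw]
        ring
    · push Not at hx
      refine ⟨_, ?_, mul_le_mul_of_nonneg_right
        (div_le_div_of_nonneg_right (sub_le_self _ one_pos.le) ht.le) (hpos x).le⟩
      refine Eq.mpr (congrArg (fun f => HasSum f _) (funext fun w => ?_)) ((hsumx x).mul_right (h x))
      by_cases hxw : T.Adj x w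
      · have h2 : h w = h x * f x w := X.geodesicProd_of_notMem f hxw (hx w hxw)
        rw [h2, ← hout x w hxw]; ring
      · rw [X.eq_zero_of_not_adj hxw, hzero x w hxw]
        ring
  choose a ha hale using key
  have hnn : 0 ≤ X.PhiReal hinv o t / t := by
    have h1 := ((ha o).nonneg fun y => mul_nonneg (X.nonneg o y) (hpos y).le).trans (hale o)
    exact nonneg_of_mul_nonneg_left h1 (hpos o)
  refine X.rho_le_of_pn_le hnn fun n => ?_
  exact le_of_mul_le_mul_right (X.pn_mul_le hpos hnn (fun x => (ha x).summable)
    (fun x => (ha x).tsum_eq.trans_le (hale x)) n o o) (hpos o)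

end Walk
end TreeWalk

/-! ### The minimum of Φ(t)/t -/

namespace TreeWalk
namespace Walk

variable {V : Type*} {T : SimpleGraph V} {Γ : Subgroup (T ≃g T)} (X : Walk T)
  (hinv : X.Invariant Γ)

theorem phiReal_eq_sqrtSum (o : V) : X.PhiReal hinv o = sqrtSum (X.weight o) :=
  funext fun t => X.phiReal_eq hinv o t

theorem deriv_phiReal_eq_iff (o : V) {t : ℝ} (ht : 0 < t) :
    deriv (X.PhiReal hinv o) t = X.PhiReal hinv o t / t ↔ defectSum (X.weight o) t = 1 := by
  have h1 := sqrtSum_sub (X.weight_nonneg o) (X.summable_weight o) t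
  rw [phiReal_eq_sqrtSum, (hasDerivAt_sqrtSum (X.weight_nonneg o) (X.summable_weight o) t).deriv,
    eq_div_iff ht.ne']
  constructor <;> intro h <;> linarith

/-- The condition on s says that the tangent at s passes through the origin; the graph of Φ lies
above this line. -/
theorem phiReal_div_le {o : V} {s t : ℝ} (hs : 0 < s) (ht : 0 < t)
    (h : deriv (X.PhiReal hinv o) s = X.PhiReal hinv o s / s) :
    X.PhiReal hinv o s / s ≤ X.PhiReal hinv o t / t := by
  have h1 := sqrtSum_tangent_le (X.weight_nonneg o) (X.summable_weight o) s t
  rw [← (hasDerivAt_sqrtSum (X.weight_nonneg o) (X.summable_weight o) s).deriv,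
    ← X.phiReal_eq_sqrtSum hinv, h] at h1
  rw [le_div_iff₀ ht]
  refine le_of_eq_of_le ?_ h1
  field_simp
  ring

theorem exists_deriv_phiReal_eq {o : V} (hdeg : 3 ≤ (T.neighborSet o).encard) :
    ∃ s, 0 < s ∧ deriv (X.PhiReal hinv o) s = X.PhiReal hinv o s / s ∧
      ∀ t, 0 < t → deriv (X.PhiReal hinv o) t = X.PhiReal hinv o t / t → t = s := by
  obtain ⟨F, hFs, hF⟩ := Set.exists_subset_encard_eq hdeg
  have hfin : F.Finite := Set.finite_of_encard_eq_coe (k := 3) hF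
  have hcard : 3 ≤ hfin.toFinset.card := by
    rw [hfin.encard_eq_coe_toFinset_card] at hF
    exact (by exact_mod_cast hF : hfin.toFinset.card = 3).ge
  obtain ⟨s, hs, hs1, hs2⟩ := exists_defectSum_eq_one (X.weight_nonneg o) (X.summable_weight o)
    hcard fun y hy => X.weight_pos (hFs (hfin.mem_toFinset.1 hy))
  exact ⟨s, hs, (X.deriv_phiReal_eq_iff hinv o hs).2 hs1, fun t ht h =>
    hs2 t ht ((X.deriv_phiReal_eq_iff hinv o ht).1 h)⟩

end Walk
end TreeWalk

theorem theorem5p2 {V : Type*} [Countable V] [MeasurableSpace V] [DiscreteMeasurableSpace V]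
    {T : SimpleGraph V} (X : TreeWalk.Walk T) (Γ : Subgroup (T ≃g T))
    (htrans : TreeWalk.Transitive Γ) (hinv : X.Invariant Γ) (o : V)
    (hdeg : ∀ x : V, 3 ≤ (T.neighborSet x).encard)
    (hsum : Summable fun j : TreeWalk.EdgeType Γ =>
      (TreeWalk.EdgeType.deg Γ o j : ℝ) * X.pType hinv (TreeWalk.EdgeType.neg Γ j)) :
    -- the functional equation on the domain `𝒰`
    (∀ z ∈ X.domU hinv o,
      z ∈ resolventSet ℂ (X.op o) ∧
      ∀ x : V, X.green o x x z ∈ X.domW hinv ∧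
        z * X.green o x x z = X.Phi hinv o (X.green o x x z)) ∧
    -- `Φ` is given by an absolutely convergent series, and is analytic, on `𝒲`
    (∀ t ∈ X.domW hinv, Summable fun j => ‖X.phiTerm hinv o t j‖) ∧
    AnalyticOnNhd ℂ (X.Phi hinv o) (X.domW hinv) ∧
    -- on the real line, `Φ` is real
    (∀ t : ℝ, X.Phi hinv o (t : ℂ) = (X.PhiReal hinv o t : ℂ)) ∧
    -- `ρ` is the minimum of `Φ(t) / t`, attained at the unique solution of `Φ'(t) = Φ(t) / t`
    IsLeast ((fun t : ℝ => X.PhiReal hinv o t / t) '' Set.Ioi 0) (X.rho o) ∧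
    ∃ θ : ℝ, 0 < θ ∧
      deriv (X.PhiReal hinv o) θ = X.PhiReal hinv o θ / θ ∧
      (∀ t : ℝ, 0 < t → deriv (X.PhiReal hinv o) t = X.PhiReal hinv o t / t → t = θ) ∧
      X.rho o = X.PhiReal hinv o θ / θ := by

  obtain ⟨θ, hθ, hθ1, hθ2⟩ := X.exists_deriv_phiReal_eq hinv (hdeg o)
  obtain ⟨u, hu⟩ : (T.neighborSet o).Nonempty := by
    rw [← Set.encard_pos]
    exact lt_of_lt_of_le (by norm_num) (hdeg o)
  have hrho : X.rho o = X.PhiReal hinv o θ / θ := by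
    refine le_antisymm (X.rho_le_phiReal_div hinv htrans o hθ) ?_
    -- Every s > ρ is itself a value Φ(g)/g with g > 0, so it cannot lie below the value at θ.
    refine le_of_forall_gt_imp_ge_of_dense fun s hs => ?_
    obtain ⟨g, hg, hsg⟩ := X.exists_green_eq_ofReal hinv htrans hs
    exact (X.phiReal_div_le hinv hθ hg hθ1).trans_eq (by rw [← hsg, mul_div_cancel_right₀ _ hg.ne'])
  refine ⟨fun z hz => ⟨X.mem_resolventSet_of_norm_op_lt (X.norm_op_lt hinv htrans hz), fun x =>
    ⟨X.green_mem_domW hinv htrans hu hz x, X.functional_equation hinv htrans hz x⟩⟩,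
    fun t _ => X.summable_norm_phiTerm hinv o t, X.analyticOnNhd_phi hinv o,
    X.phi_ofReal hinv o, ⟨⟨θ, hθ, hrho.symm⟩, ?_⟩, θ, hθ, hθ1, hθ2, hrho⟩
  rintro _ ⟨t, ht, rfl⟩
  exact X.rho_le_phiReal_div hinv htrans o ht
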